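/- Let $\theta\in\mathbb{R}$ with $|\theta|<\pi/2$, and let $H=-e^{-i\theta}\frac{d^2}{dx^2}+e^{i\theta}x^2$ be the rotated harmonic oscillator in $L^2(\mathbb{R})=L^2(\mathbb{R};\mathbb{C})$, acting in the sense of distributions on its maximal domain $\{\psi\in L^2(\mathbb{R}) : -e^{-i\theta}\psi''+e^{i\theta}x^2\psi\in L^2(\mathbb{R})\}$. For every $k\in\{0,1,2,\dots\}$ the number $2k+1$ is an eigenvalue of $H$ and an isolated point of its spectrum; let $$P_k=-\frac{1}{2\pi i}\oint_{|z-(2k+1)|=r}(H-z)^{-1}\,dz$$ be the corresponding spectral (Riesz) projection, where $r>0$ is any radius such that $2k+1$ is the only point of the spectrum in the closed disc $|z-(2k+1)|\le r$ (the result does not depend on $r$). Let $\mathcal{P}_k(x)=\frac{1}{2^k k!}\frac{d^k}{dx^k}(x^2-1)^k$ denote the $k$-th Legendre polynomial. Then: 1. for every $k\ge 0$, the operator norm of $P_k$ is $$\|P_k\|=\frac{1}{(\cos\theta)^{1/2}}\,\mathcal{P}_k\!\left(\frac{1}{\cos\theta}\right);$$ 2. if $\theta\neq 0$, then, as $k\to\infty$,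 $$\|P_k\|=\frac{1}{\sqrt{2\pi k|\sin\theta|}}\left(\frac{1+|\sin\theta|}{\cos\theta}\right)^{k+1/2}(1+o(1));$$ 3. $$\lim_{k\to\infty}\frac{\log\|P_k\|}{k}=\frac12\log\left(\frac{1+|\sin\theta|}{1-|\sin\theta|}\right).$$ -/

import Mathlib

open MeasureTheory Filter Topology
open scoped SchwartzMap

noncomputable section

/-! ## Spectral theory of a partially defined operator on a complex Banach space -/

namespace UnboundedOp

variable {E : Type*} [NormedAddCommGroup E] [NormedSpace ℂ E]

/-- The bounded operator `R` is a two-sided inverse of `T - z : Dom T → E`. -/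
def IsResolventAt (T : E →ₗ.[ℂ] E) (z : ℂ) (R : E →L[ℂ] E) : Prop :=
  (∀ f : E, ∃ u : T.domain, (u : E) = R f ∧ T u - z • (u : E) = f) ∧
    ∀ u : T.domain, R (T u - z • (u : E)) = u

/-- The resolvent set: all `z` for which `(T - z)⁻¹` exists as a bounded operator on `E`. -/
def resolventSet (T : E →ₗ.[ℂ] E) : Set ℂ :=
  {z | ∃ R : E →L[ℂ] E, IsResolventAt T z R}

/-- The spectrum: the complement of the resolvent set. -/
def spectrum (T : E →ₗ.[ℂ] E) : Set ℂ :=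
  (resolventSet T)ᶜ

open Classical in
/-- The resolvent `(T - z)⁻¹` at a point `z` of the resolvent set (and `0` elsewhere). -/
def resolvent (T : E →ₗ.[ℂ] E) (z : ℂ) : E →L[ℂ] E :=
  if h : ∃ R : E →L[ℂ] E, IsResolventAt T z R then h.choose else 0

/-- `z` is an eigenvalue: `T u = z u` for some nonzero `u` in the domain. -/
def HasEigenvalue (T : E →ₗ.[ℂ] E) (z : ℂ) : Prop :=
  ∃ u : T.domain, (u : E) ≠ 0 ∧ T u = z • (u : E)

/-- The contour integral `-(2πi)⁻¹ ∮ (T - z)⁻¹ dz` over the positively oriented circle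
`|z - lam| = r`. -/
def contourProjection (T : E →ₗ.[ℂ] E) (lam : ℂ) (r : ℝ) : E →L[ℂ] E :=
  -(2 * Real.pi * Complex.I)⁻¹ • circleIntegral (resolvent T) lam r

/-- `P` is the spectral (Riesz) projection of `T` at the isolated point `lam` of its spectrum:
`P` is the contour integral of the resolvent over every circle around `lam` for which `lam` is the
only spectral point in the closed disc. There is such a circle, so `P` is unique. -/
def IsSpectralProjection (T : E →ₗ.[ℂ] E) (lam : ℂ) (P : E →L[ℂ] E) : Prop :=
  lam ∈ spectrum T ∧
  (∃ r : ℝ, 0 < r ∧ Metric.closedBall lam r \ {lam} ⊆ resolventSet T) ∧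
  ∀ r : ℝ, 0 < r → Metric.closedBall lam r \ {lam} ⊆ resolventSet T →
    P = contourProjection T lam r

/-- The resolvent at a point is unique. -/
theorem IsResolventAt.unique {T : E →ₗ.[ℂ] E} {z : ℂ} {R R' : E →L[ℂ] E}
    (h : IsResolventAt T z R) (h' : IsResolventAt T z R') : R = R' := by
  ext f
  obtain ⟨u, hu, huf⟩ := h.1 f
  rw [← hu, ← huf, h'.2 u]

/-- The spectral projection at an isolated point of the spectrum is unique. -/
theorem IsSpectralProjection.unique {T : E →ₗ.[ℂ] E} {lam : ℂ} {P P' : E →L[ℂ] E}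
    (h : IsSpectralProjection T lam P) (h' : IsSpectralProjection T lam P') : P = P' := by
  obtain ⟨r, hr, hs⟩ := h.2.1
  rw [h.2.2 r hr hs, h'.2.2 r hr hs]

end UnboundedOp

/-! ## The rotated harmonic oscillator -/

namespace RotatedOscillator

/-- The Hilbert space `L²(ℝ; ℂ)`. -/
abbrev L2 : Type := Lp ℂ 2 (volume : Measure ℝ)

/-- The inclusion of `L²(ℝ)` in the tempered distributions. -/
def toDist : L2 →L[ℂ] 𝓢'(ℝ, ℂ) :=
  Lp.toTemperedDistributionCLM ℂ (volume : Measure ℝ) 2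

/-- The differential expression `-e^{-iθ} d²/dx² + e^{iθ} x²` acting on tempered distributions. -/
def expression (θ : ℝ) : 𝓢'(ℝ, ℂ) →L[ℂ] 𝓢'(ℝ, ℂ) :=
  -Complex.exp (-(Complex.I * θ)) •
      (TemperedDistribution.derivCLM ℂ ∘L TemperedDistribution.derivCLM ℂ)
    + Complex.exp (Complex.I * θ) • TemperedDistribution.smulLeftCLM ℂ (fun x : ℝ ↦ (x : ℂ) ^ 2)

/-- All pairs `(ψ, f)` in `L²(ℝ) × L²(ℝ)` with `-e^{-iθ} ψ'' + e^{iθ} x² ψ = f` in the sense of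
distributions. -/
def graph (θ : ℝ) : Submodule ℂ (L2 × L2) :=
  LinearMap.eqLocus
    ((expression θ).toLinearMap ∘ₗ toDist.toLinearMap ∘ₗ LinearMap.fst ℂ L2 L2)
    (toDist.toLinearMap ∘ₗ LinearMap.snd ℂ L2 L2)

/-- The rotated harmonic oscillator `H = -e^{-iθ} d²/dx² + e^{iθ} x²` in `L²(ℝ)` on its maximal
domain `{ψ ∈ L²(ℝ) | -e^{-iθ} ψ'' + e^{iθ} x² ψ ∈ L²(ℝ)}`. -/
def H (θ : ℝ) : L2 →ₗ.[ℂ] L2 :=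
  (graph θ).toLinearPMap

/-- The operator `H` has the graph it was built from. -/
theorem H_graph (θ : ℝ) : (H θ).graph = graph θ := by
  refine Submodule.toLinearPMap_graph_eq _ fun x hx hx' ↦ ?_
  have h : expression θ (toDist x.1) = toDist x.2 := hx
  rw [hx', map_zero, map_zero] at h
  have hk : x.2 ∈ (toDist : L2 →L[ℂ] 𝓢'(ℝ, ℂ)).ker := h.symm
  rw [toDist, Lp.ker_toTemperedDistributionCLM_eq_bot] at hk
  simpa using hk

end RotatedOscillator

/-- The `k`-th Legendre polynomial, by Rodrigues' formula
`(2^k k!)⁻¹ (d/dx)^k (x² - 1)^k`. -/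
def legendrePoly (k : ℕ) : Polynomial ℝ :=
  Polynomial.C ((2 ^ k * (k.factorial : ℝ))⁻¹) *
    Polynomial.derivative^[k] ((Polynomial.X ^ 2 - 1) ^ k)

end

/-! With c = e^{iθ/2}, the ladder operators cx ∓ c⁻¹ d/dx satisfy [lower, raise] = 2 and H =
raise·lower + 1. Raising the Gaussian exp(-e^{iθ}x²/2) k times therefore gives an eigenfunction φ_k
with eigenvalue 2k+1. H is not normal in general, but it is symmetric for the bilinear form ∫uv, so
the φ_k are orthogonal in that form. The natural candidate is P_k f = (∫φ_k f / ∫φ_k²) φ_k, whose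
norm is ‖φ_k‖² / |∫φ_k²|.

This candidate is the Riesz projection because the φ_k have dense span (`dense_span_eigenfunction`)
and H has a compact inverse (`exists_compact_inverse`). The resolvent then exists off the points
2k+1, and on each φ_j the contour integral is a scalar Cauchy integral
(`isSpectralProjection_of_complete`).

The denominator is 2^k k! √π. For the numerator, the ladder relations give a recurrence for the
pairings ∫ conj(φ_m) φ_n, solved by the coefficients of powers of a quadratic (`gram_eq_coeff`). The
central coefficient is a Legendre value at 1/cos θ (`gram_self`). Laplace's integral for Legendre
polynomials, followed by Laplace's method (`tendsto_sqrt_mul_integral_pow`), gives the asymptotics,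
and logarithms give the growth rate. -/

noncomputable section

namespace RotatedOscillator

/-! ## Position and derivative on the Schwartz space -/

/-- Multiplication by the coordinate on the Schwartz space. -/
def X : 𝓢(ℝ, ℂ) →L[ℂ] 𝓢(ℝ, ℂ) := SchwartzMap.smulLeftCLM ℂ (fun x : ℝ ↦ (x : ℂ))

/-- The derivative on the Schwartz space. -/
def D : 𝓢(ℝ, ℂ) →L[ℂ] 𝓢(ℝ, ℂ) := SchwartzMap.derivCLM ℂ ℂ

@[simp]
theorem X_apply (u : 𝓢(ℝ, ℂ)) (x : ℝ) : X u x = x * u x := by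
  have h : (fun x : ℝ ↦ (x : ℂ)).HasTemperateGrowth :=
    Function.Complex.hasTemperateGrowth_ofReal
  simp [X, SchwartzMap.smulLeftCLM_apply_apply h]

theorem D_apply (u : 𝓢(ℝ, ℂ)) (x : ℝ) : D u x = deriv u x := rfl

theorem hasDerivAt_D (u : 𝓢(ℝ, ℂ)) (x : ℝ) : HasDerivAt u (D u x) x := u.hasDerivAt x

theorem D_X (u : 𝓢(ℝ, ℂ)) : D (X u) = u + X (D u) := by
  ext x
  have h1 : HasDerivAt (fun y : ℝ ↦ (y : ℂ)) 1 x := Complex.ofRealCLM.hasDerivAt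
  have h2 : HasDerivAt (X u) (1 * u x + x * D u x) x := by
    convert! h1.mul (hasDerivAt_D u x) using 1
    ext y
    simp
  rw [D_apply, h2.deriv]
  simp

/-- The formal differential expression of the rotated oscillator on the Schwartz space. -/
def schwartzOp (θ : ℝ) (u : 𝓢(ℝ, ℂ)) : 𝓢(ℝ, ℂ) :=
  -Complex.exp (-(Complex.I * θ)) • D (D u) + Complex.exp (Complex.I * θ) • X (X u)

/-- The raising operator `c x - c⁻¹ d/dx`. -/
def raise (c : ℂ) : 𝓢(ℝ, ℂ) →L[ℂ] 𝓢(ℝ, ℂ) := c • X - c⁻¹ • D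

/-- The lowering operator `c x + c⁻¹ d/dx`. -/
def lower (c : ℂ) : 𝓢(ℝ, ℂ) →L[ℂ] 𝓢(ℝ, ℂ) := c • X + c⁻¹ • D

theorem raise_apply (c : ℂ) (u : 𝓢(ℝ, ℂ)) : raise c u = c • X u - c⁻¹ • D u := rfl

theorem lower_apply (c : ℂ) (u : 𝓢(ℝ, ℂ)) : lower c u = c • X u + c⁻¹ • D u := rfl

/-- The canonical commutation relation: [d/dx, x] = 1 contributes twice, and the factors c and c⁻¹
cancel. -/
theorem lower_raise {c : ℂ} (hc : c ≠ 0) (u : 𝓢(ℝ, ℂ)) :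
    lower c (raise c u) = raise c (lower c u) + (2 : ℂ) • u := by
  ext x
  simp only [raise_apply, lower_apply, map_add, map_sub, map_smul, D_X, add_apply,
    sub_apply, smul_apply, smul_eq_mul]
  field_simp
  ring

theorem raise_add_lower {c : ℂ} (hc : c ≠ 0) (u : 𝓢(ℝ, ℂ)) :
    X u = (2 * c)⁻¹ • (raise c u + lower c u) := by
  ext x
  simp only [raise_apply, lower_apply, add_apply,
    sub_apply, smul_apply, smul_eq_mul]
  field_simp
  ring

/-- Factorisation of H: squaring c produces the coefficients e^{±iθ}, and the commutator of x and
d/dx costs 1. -/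
theorem raise_lower_eq {c : ℂ} (hc : c ≠ 0) {θ : ℝ} (h : c ^ 2 = Complex.exp (Complex.I * θ))
    (u : 𝓢(ℝ, ℂ)) : raise c (lower c u) = schwartzOp θ u - u := by
  ext x
  have hi : Complex.exp (-(Complex.I * θ)) = (c ^ 2)⁻¹ := by rw [h, Complex.exp_neg]
  simp only [schwartzOp, hi, ← h, raise_apply, lower_apply, map_add, map_smul, D_X,
    add_apply, sub_apply, smul_apply, smul_eq_mul]
  field_simp
  ring

/-! ## Complex Gaussians -/

theorem abs_pow_mul_exp_le {a : ℝ} (ha : 0 < a) (m : ℕ) (x : ℝ) :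
    |x| ^ m * Real.exp (-(a * x ^ 2)) ≤ m.factorial * Real.exp (1 / (4 * a)) := by
  have h1 : |x| ^ m ≤ m.factorial * Real.exp |x| := by
    have := Real.pow_div_factorial_le_exp |x| (abs_nonneg x) m
    rwa [div_le_iff₀' (by positivity)] at this
  -- Completing the square; the maximum is at |x| = 1/(2a).
  have h2 : |x| - a * x ^ 2 ≤ 1 / (4 * a) := by
    rw [le_div_iff₀ (by positivity), ← sq_abs x]
    nlinarith [sq_nonneg (2 * a * |x| - 1)]
  calc |x| ^ m * Real.exp (-(a * x ^ 2))
      ≤ m.factorial * Real.exp |x| * Real.exp (-(a * x ^ 2)) := by gcongr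
    _ = m.factorial * Real.exp (|x| - a * x ^ 2) := by rw [mul_assoc, ← Real.exp_add]; rfl
    _ ≤ _ := by gcongr

theorem norm_exp_neg_mul_sq (b : ℂ) (x : ℝ) :
    ‖Complex.exp (-(b * x ^ 2 / 2))‖ = Real.exp (-(b.re / 2 * x ^ 2)) := by
  rw [Complex.norm_exp]
  congr 1
  simp [← Complex.ofReal_pow]
  ring

theorem exists_bound_polynomial_mul_gaussian {b : ℂ} (hb : 0 < b.re) (p : Polynomial ℂ) :
    ∃ C : ℝ, ∀ x : ℝ, ‖p.eval (x : ℂ) * Complex.exp (-(b * x ^ 2 / 2))‖ ≤ C := by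
  induction p using Polynomial.induction_on' with
  | add p q hp hq =>
    obtain ⟨C, hC⟩ := hp
    obtain ⟨C', hC'⟩ := hq
    refine ⟨C + C', fun x ↦ ?_⟩
    rw [Polynomial.eval_add, add_mul]
    exact (norm_add_le _ _).trans (add_le_add (hC x) (hC' x))
  | monomial n a =>
    refine ⟨‖a‖ * (n.factorial * Real.exp (1 / (4 * (b.re / 2)))), fun x ↦ ?_⟩
    rw [norm_mul, norm_exp_neg_mul_sq, Polynomial.eval_monomial, norm_mul, norm_pow,
      Complex.norm_real, Real.norm_eq_abs, mul_assoc]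
    exact mul_le_mul_of_nonneg_left (abs_pow_mul_exp_le (by positivity) n x) (norm_nonneg _)

theorem hasDerivAt_exp_neg_mul_sq (b : ℂ) (x : ℝ) :
    HasDerivAt (fun x : ℝ ↦ Complex.exp (-(b * x ^ 2 / 2)))
      (-(b * x) * Complex.exp (-(b * x ^ 2 / 2))) x := by
  have h1 : HasDerivAt (fun y : ℝ ↦ (y : ℂ)) 1 x := Complex.ofRealCLM.hasDerivAt
  convert! (((h1.pow 2).const_mul b).div_const 2).neg.cexp using 1
  simp
  ring

theorem iteratedDeriv_exp_neg_mul_sq (b : ℂ) (n : ℕ) :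
    ∃ p : Polynomial ℂ, iteratedDeriv n (fun x : ℝ ↦ Complex.exp (-(b * x ^ 2 / 2))) =
      fun x : ℝ ↦ p.eval (x : ℂ) * Complex.exp (-(b * x ^ 2 / 2)) := by
  induction n with
  | zero => exact ⟨1, by simp⟩
  | succ n ih =>
    obtain ⟨p, hp⟩ := ih
    refine ⟨p.derivative - Polynomial.C b * Polynomial.X * p, ?_⟩
    rw [iteratedDeriv_succ, hp]
    ext x
    have h1 : HasDerivAt (fun y : ℝ ↦ p.eval (y : ℂ)) (p.derivative.eval (x : ℂ)) x :=
      (p.hasDerivAt (x : ℂ)).comp_ofReal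
    refine (h1.mul (hasDerivAt_exp_neg_mul_sq b x)).deriv.trans ?_
    simp
    ring

/-- The Gaussian `x ↦ exp (-b x² / 2)` as a Schwartz function, for `0 < re b`. -/
def gaussianSchwartz (b : ℂ) (hb : 0 < b.re) : 𝓢(ℝ, ℂ) where
  toFun x := Complex.exp (-(b * x ^ 2 / 2))
  smooth' := by
    have : ContDiff ℝ (⊤ : ℕ∞) (fun x : ℝ ↦ (x : ℂ)) := Complex.ofRealCLM.contDiff
    fun_prop
  decay' k n := by
    obtain ⟨p, hp⟩ := iteratedDeriv_exp_neg_mul_sq b n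
    obtain ⟨C, hC⟩ := exists_bound_polynomial_mul_gaussian hb (Polynomial.X ^ k * p)
    refine ⟨C, fun x ↦ ?_⟩
    rw [norm_iteratedFDeriv_eq_norm_iteratedDeriv, hp]
    refine le_trans (le_of_eq ?_) (hC x)
    simp [mul_assoc]

open Classical in
/-- The ground state `x ↦ exp (-e^{iθ} x² / 2)` of the rotated oscillator (junk value `0` if
`cos θ ≤ 0`). -/
def groundState (θ : ℝ) : 𝓢(ℝ, ℂ) :=
  if h : 0 < (Complex.exp (Complex.I * θ)).re then gaussianSchwartz _ h else 0

theorem re_exp_I_mul (θ : ℝ) : (Complex.exp (Complex.I * θ)).re = Real.cos θ := by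
  rw [mul_comm, Complex.exp_ofReal_mul_I_re]

theorem groundState_apply {θ : ℝ} (hθ : 0 < Real.cos θ) (x : ℝ) :
    groundState θ x = Complex.exp (-(Complex.exp (Complex.I * θ) * x ^ 2 / 2)) := by
  rw [groundState, dif_pos (by rwa [re_exp_I_mul])]
  rfl

theorem D_groundState {θ : ℝ} (hθ : 0 < Real.cos θ) :
    D (groundState θ) = -Complex.exp (Complex.I * θ) • X (groundState θ) := by
  ext x
  have : ⇑(groundState θ) = fun x : ℝ ↦ Complex.exp (-(Complex.exp (Complex.I * θ) * x ^ 2 / 2)) :=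
    funext (groundState_apply hθ)
  rw [D_apply, this, (hasDerivAt_exp_neg_mul_sq _ x).deriv]
  simp [groundState_apply hθ]
  ring

/-! ## The eigenfunctions -/

/-- The rotation factor `e^{iθ/2}`. -/
def rot (θ : ℝ) : ℂ := Complex.exp (Complex.I * θ / 2)

theorem rot_ne_zero (θ : ℝ) : rot θ ≠ 0 := Complex.exp_ne_zero _

theorem rot_sq (θ : ℝ) : rot θ ^ 2 = Complex.exp (Complex.I * θ) := by
  rw [rot, ← Complex.exp_nat_mul]
  congr 1
  push_cast
  ring

theorem rot_neg (θ : ℝ) : rot (-θ) = (rot θ)⁻¹ := by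
  rw [rot, rot, ← Complex.exp_neg]
  congr 1
  push_cast
  ring

/-- The (unnormalised) eigenfunctions, obtained from the ground state by the raising operator. -/
def eigenfunction (θ : ℝ) : ℕ → 𝓢(ℝ, ℂ)
  | 0 => groundState θ
  | n + 1 => raise (rot θ) (eigenfunction θ n)

theorem eigenfunction_zero (θ : ℝ) : eigenfunction θ 0 = groundState θ := rfl

theorem eigenfunction_succ (θ : ℝ) (n : ℕ) :
    eigenfunction θ (n + 1) = raise (rot θ) (eigenfunction θ n) := rfl

/-- The commutation relation adds 2 at each rung. At n = 0 the truncated index n - 1 is harmless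
because the coefficient 2n vanishes. -/
theorem lower_eigenfunction {θ : ℝ} (hθ : 0 < Real.cos θ) (n : ℕ) :
    lower (rot θ) (eigenfunction θ n) = (2 * n : ℂ) • eigenfunction θ (n - 1) := by
  induction n with
  | zero =>
    have hr := rot_ne_zero θ
    rw [eigenfunction_zero, lower_apply, D_groundState hθ, ← rot_sq]
    ext x
    simp
    field_simp
    ring
  | succ n ih =>
    rw [eigenfunction_succ, lower_raise (rot_ne_zero θ), ih, map_smul]
    rcases n with _ | n
    · simp
    · simp only [Nat.add_sub_cancel, ← eigenfunction_succ, ← add_smul]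
      congr 1
      push_cast
      ring

theorem schwartzOp_eigenfunction {θ : ℝ} (hθ : 0 < Real.cos θ) (n : ℕ) :
    schwartzOp θ (eigenfunction θ n) = (2 * n + 1 : ℂ) • eigenfunction θ n := by
  have h := raise_lower_eq (rot_ne_zero θ) (rot_sq θ) (eigenfunction θ n)
  rw [lower_eigenfunction hθ, map_smul, ← eigenfunction_succ, eq_sub_iff_add_eq] at h
  rw [← h, add_smul, one_smul]
  rcases n with _ | n <;> simp

theorem X_eigenfunction {θ : ℝ} (hθ : 0 < Real.cos θ) (n : ℕ) :
    X (eigenfunction θ n) = (2 * rot θ)⁻¹ •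
      (eigenfunction θ (n + 1) + (2 * n : ℂ) • eigenfunction θ (n - 1)) := by
  rw [raise_add_lower (rot_ne_zero θ), lower_eigenfunction hθ, eigenfunction_succ]

/-! ## The bilinear form and complex conjugation -/

/-- The bilinear form `∫ u v` on the Schwartz space. -/
def bil : 𝓢(ℝ, ℂ) →ₗ[ℂ] 𝓢(ℝ, ℂ) →ₗ[ℂ] ℂ :=
  have hint (u v : 𝓢(ℝ, ℂ)) : Integrable fun x ↦ u x * v x :=
    (SchwartzMap.pairing (ContinuousLinearMap.mul ℂ ℂ) u v).integrable
  LinearMap.mk₂ ℂ (fun u v ↦ ∫ x, u x * v x)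
    (fun u u' v ↦ by
      simp only [add_apply, add_mul]
      exact integral_add (hint u v) (hint u' v))
    (fun a u v ↦ by
      simp only [smul_apply, smul_eq_mul, mul_assoc]
      exact integral_const_mul _ _)
    (fun u v v' ↦ by
      simp only [add_apply, mul_add]
      exact integral_add (hint u v) (hint u v'))
    (fun a u v ↦ by
      simp only [smul_apply, smul_eq_mul, mul_left_comm]
      exact integral_const_mul _ _)

theorem bil_apply (u v : 𝓢(ℝ, ℂ)) : bil u v = ∫ x, u x * v x := rfl

theorem bil_comm (u v : 𝓢(ℝ, ℂ)) : bil u v = bil v u := by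
  simp only [bil_apply, mul_comm]

theorem bil_X (u v : 𝓢(ℝ, ℂ)) : bil (X u) v = bil u (X v) := by
  simp only [bil_apply, X_apply]
  congr 1
  ext x
  ring

theorem bil_D (u v : 𝓢(ℝ, ℂ)) : bil (D u) v = -bil u (D v) := by
  have := SchwartzMap.integral_mul_deriv_eq_neg_deriv_mul u v
  simp only [bil_apply, D_apply, this, neg_neg]

theorem bil_raise (c : ℂ) (u v : 𝓢(ℝ, ℂ)) : bil (raise c u) v = bil u (lower c v) := by
  simp only [raise_apply, lower_apply, map_sub, map_smul, map_add, LinearMap.sub_apply,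
    LinearMap.smul_apply, bil_X, bil_D, smul_neg, sub_neg_eq_add]

/-- No conjugate is taken, so the complex coefficients pass through unchanged; this symmetry
replaces self-adjointness. -/
theorem bil_schwartzOp (θ : ℝ) (u v : 𝓢(ℝ, ℂ)) :
    bil (schwartzOp θ u) v = bil u (schwartzOp θ v) := by
  simp only [schwartzOp, map_smul, map_add, LinearMap.add_apply,
    LinearMap.smul_apply, bil_X, bil_D, neg_neg]

/-- Complex conjugation on the Schwartz space. -/
def conj (u : 𝓢(ℝ, ℂ)) : 𝓢(ℝ, ℂ) :=
  SchwartzMap.postcompCLM (𝕜 := ℝ) (Complex.conjCLE : ℂ →L[ℝ] ℂ) u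

@[simp]
theorem conj_apply (u : 𝓢(ℝ, ℂ)) (x : ℝ) : conj u x = starRingEnd ℂ (u x) := rfl

theorem conj_conj (u : 𝓢(ℝ, ℂ)) : conj (conj u) = u := by
  ext x
  simp

theorem conj_D (u : 𝓢(ℝ, ℂ)) : conj (D u) = D (conj u) := by
  ext x
  have h : HasDerivAt (conj u) (starRingEnd ℂ (D u x)) x :=
    (Complex.conjCLE : ℂ →L[ℝ] ℂ).hasFDerivAt.comp_hasDerivAt x (hasDerivAt_D u x)
  rw [D_apply (conj u), h.deriv, conj_apply]

theorem conj_X (u : 𝓢(ℝ, ℂ)) : conj (X u) = X (conj u) := by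
  ext x
  simp

theorem conj_raise (c : ℂ) (u : 𝓢(ℝ, ℂ)) :
    conj (raise c u) = raise (starRingEnd ℂ c) (conj u) := by
  ext x
  have h := congrArg (fun v : 𝓢(ℝ, ℂ) ↦ v x) (conj_D u)
  simp only [conj_apply] at h
  simp [raise_apply, h]

theorem conj_rot (θ : ℝ) : starRingEnd ℂ (rot θ) = rot (-θ) := by
  rw [rot, rot, ← Complex.exp_conj]
  simp [map_ofNat]

/-- Links the bilinear form to the inner product: conjugation inverts the unimodular factor c, so it
exchanges θ and -θ. -/
theorem conj_eigenfunction {θ : ℝ} (hθ : 0 < Real.cos θ) (n : ℕ) :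
    conj (eigenfunction θ n) = eigenfunction (-θ) n := by
  induction n with
  | zero =>
    ext x
    rw [conj_apply, eigenfunction_zero, eigenfunction_zero, groundState_apply hθ,
      groundState_apply (by rwa [Real.cos_neg]), ← Complex.exp_conj]
    simp [← Complex.exp_conj, map_ofNat]
  | succ n ih => rw [eigenfunction_succ, eigenfunction_succ, conj_raise, ih, conj_rot]

end RotatedOscillator

/-! ## Central coefficients of powers of quadratic polynomials -/

section CentralCoefficient

open Polynomial

variable {F : Type*} [Field F]

/-- Compare coefficients in (q^{N+1})' = (N+1) q' q^N. This is the recurrence matched against the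
Gram entries. -/
theorem coeff_quadratic_pow_succ (α γ β : F) (N m : ℕ) :
    ((m : F) + 1) * ((C α * X ^ 2 + C γ * X + C β) ^ (N + 1)).coeff (m + 1) = ((N : F) + 1) *
      (2 * α * (if m = 0 then 0 else ((C α * X ^ 2 + C γ * X + C β) ^ N).coeff (m - 1)) +
        γ * ((C α * X ^ 2 + C γ * X + C β) ^ N).coeff m) := by
  set q : F[X] := C α * X ^ 2 + C γ * X + C β with hq
  have h1 : derivative (q ^ (N + 1)) =
      C ((N : F) + 1) * (C (2 * α) * (q ^ N * X) + C γ * q ^ N) := by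
    rw [derivative_pow_succ]
    have h2 : derivative q = C (2 * α) * X + C γ := by
      simp only [hq, derivative_add, derivative_mul, derivative_C, derivative_X_pow, derivative_X,
        Nat.cast_ofNat, C_mul, map_ofNat]
      ring
    rw [h2]
    simp only [map_add, map_natCast, C_mul, map_one, map_ofNat]
    ring
  have h3 := congrArg (fun p : F[X] ↦ p.coeff m) h1
  simp only [coeff_derivative, coeff_C_mul, coeff_add] at h3
  rw [mul_comm, h3]
  rcases m with _ | m <;> simp

theorem coeff_quadratic_pow_zero (α γ β : F) (N : ℕ) :
    ((C α * X ^ 2 + C γ * X + C β) ^ N).coeff 0 = β ^ N := by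
  simp [coeff_zero_eq_eval_zero]

/-- The central coefficient only depends on the product of the outer coefficients. -/
theorem centralCoeff_eq (α γ β : F) (k : ℕ) :
    ((C α * X ^ 2 + C γ * X + C β) ^ k).coeff k =
      ((X ^ 2 + C γ * X + C (α * β)) ^ k).coeff k := by
  -- For α ≠ 0 the substitution X ↦ αX makes the quadratic monic and rescales the central
  -- coefficient by α^k. For α = 0 that factor cannot be cancelled, and both sides equal γ^k.
  rcases eq_or_ne α 0 with rfl | hα
  · have h1 : (X ^ 2 + C γ * X + C (0 * β) : F[X]) ^ k = (X + C γ) ^ k * X ^ k := by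
      rw [← mul_pow]
      congr 1
      simp
      ring
    have h2 := coeff_mul_X_pow ((X + C γ) ^ k) k 0
    rw [zero_add] at h2
    rw [h1, h2]
    have h3 : ∀ n : ℕ, ((C (0 : F) * X ^ 2 + C γ * X + C β) ^ n).coeff n = γ ^ n := by
      intro n
      have hd : (C (0 : F) * X ^ 2 + C γ * X + C β).natDegree ≤ 1 := by
        simpa using natDegree_linear_le (a := γ) (b := β)
      have := coeff_pow_of_natDegree_le hd (m := n)
      rw [mul_one] at this
      rw [this]
      simp
    rw [h3, coeff_zero_eq_eval_zero]
    simp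
  · have h1 : C α ^ k * (C α * X ^ 2 + C γ * X + C β) ^ k =
        ((X ^ 2 + C γ * X + C (α * β)) ^ k).comp (C α * X) := by
      rw [← mul_pow, pow_comp]
      congr 1
      simp
      ring
    have h2 := congrArg (fun p : F[X] ↦ p.coeff k) h1
    simp only [comp_C_mul_X_coeff, ← C_pow, coeff_C_mul] at h2
    rw [mul_comm] at h2
    exact mul_right_cancel₀ (pow_ne_zero k hα) h2

end CentralCoefficient

/-- Rodrigues' formula read as a Taylor coefficient: (d/dx)^k / k! extracts the k-th coefficient of
((X + x)² - 1)^k. -/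
theorem legendrePoly_eval (k : ℕ) (x : ℝ) :
    2 ^ k * (legendrePoly k).eval x = ((Polynomial.X ^ 2 + Polynomial.C (2 * x) * Polynomial.X +
      Polynomial.C (x ^ 2 - 1)) ^ k).coeff k := by
  have h1 : (Polynomial.X ^ 2 + Polynomial.C (2 * x) * Polynomial.X +
      Polynomial.C (x ^ 2 - 1)) ^ k = Polynomial.taylor x ((Polynomial.X ^ 2 - 1) ^ k) := by
    rw [Polynomial.taylor_apply, Polynomial.pow_comp]
    congr 1
    simp [map_ofNat]
    ring
  have h2 := congrFun (Polynomial.factorial_smul_hasseDeriv (R := ℝ) k)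
    ((Polynomial.X ^ 2 - 1) ^ k)
  rw [h1, Polynomial.taylor_coeff, legendrePoly, ← h2]
  simp
  field_simp

/-! ## Pairings of the eigenfunctions -/

namespace RotatedOscillator

theorem bil_eigenfunction_self {θ : ℝ} (hθ : 0 < Real.cos θ) (n : ℕ) :
    bil (eigenfunction θ n) (eigenfunction θ n) =
      2 ^ n * n.factorial * bil (groundState θ) (groundState θ) := by
  induction n with
  | zero => simp [eigenfunction_zero]
  | succ n ih =>
    nth_rw 1 [eigenfunction_succ]
    rw [bil_raise, lower_eigenfunction hθ, map_smul, Nat.add_sub_cancel, ih, Nat.factorial_succ]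
    push_cast
    simp only [smul_eq_mul]
    ring

theorem bil_eigenfunction_of_ne {θ : ℝ} (hθ : 0 < Real.cos θ) {m n : ℕ} (h : m ≠ n) :
    bil (eigenfunction θ m) (eigenfunction θ n) = 0 := by
  have h1 := bil_schwartzOp θ (eigenfunction θ m) (eigenfunction θ n)
  rw [schwartzOp_eigenfunction hθ, schwartzOp_eigenfunction hθ, map_smul, map_smul,
    LinearMap.smul_apply, ← sub_eq_zero, ← sub_smul, smul_eq_zero] at h1
  refine h1.resolve_left fun h2 ↦ h ?_
  have h3 : (2 : ℂ) * m + 1 = 2 * n + 1 := sub_eq_zero.mp h2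
  have h4 : 2 * m + 1 = 2 * n + 1 := by exact_mod_cast h3
  omega

theorem cos_eq_rot (θ : ℝ) :
    (Real.cos θ : ℂ) = (rot θ ^ 2 + (rot θ ^ 2)⁻¹) / 2 := by
  rw [rot_sq, ← Complex.exp_neg, Complex.ofReal_cos, Complex.cos]
  congr 2 <;> ring_nf

theorem I_mul_sin_eq_rot (θ : ℝ) :
    Complex.I * (Real.sin θ : ℂ) = (rot θ ^ 2 - (rot θ ^ 2)⁻¹) / 2 := by
  rw [rot_sq, ← Complex.exp_neg, Complex.ofReal_sin, Complex.sin,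
    show -(Complex.I * (θ : ℂ)) = -θ * Complex.I by ring, mul_comm Complex.I (θ : ℂ)]
  linear_combination (Complex.exp (-θ * Complex.I) - Complex.exp (θ * Complex.I)) / 2 *
    Complex.I_mul_I

/-- The conjugate ladder is a combination of the original one, which lets mixed pairings of θ and -θ
close up into a recurrence. -/
theorem lower_rot_neg (θ : ℝ) (u : 𝓢(ℝ, ℂ)) : lower (rot (-θ)) u =
    (Real.cos θ : ℂ) • lower (rot θ) u - (Complex.I * Real.sin θ) • raise (rot θ) u := by
  have hr := rot_ne_zero θ
  ext x
  simp only [rot_neg, cos_eq_rot, I_mul_sin_eq_rot, raise_apply, lower_apply, add_apply, sub_apply,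
    smul_apply, smul_eq_mul]
  field_simp
  ring

/-- The sesquilinear pairing of the eigenfunctions. -/
def gram (θ : ℝ) (m n : ℕ) : ℂ := bil (eigenfunction (-θ) m) (eigenfunction θ n)

theorem gram_neg (θ : ℝ) (m n : ℕ) : gram (-θ) m n = gram θ n m := by
  rw [gram, gram, neg_neg, bil_comm]

theorem gram_succ_aux {θ : ℝ} (hθ : 0 < Real.cos θ) (m n : ℕ) :
    gram θ (m + 1) n = Real.cos θ * (2 * n * gram θ m (n - 1)) -
      Complex.I * Real.sin θ * gram θ m (n + 1) := by
  simp only [gram]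
  rw [eigenfunction_succ, bil_raise, lower_rot_neg, lower_eigenfunction hθ, ← eigenfunction_succ]
  simp only [map_sub, map_smul, smul_eq_mul]

/-- Applying `gram_succ_aux` also at -θ eliminates the entry (m, n+1); what remains on the left is
the factor 1 - sin² θ = cos² θ, by which one divides. -/
theorem gram_succ_left {θ : ℝ} (hθ : 0 < Real.cos θ) (m n : ℕ) :
    gram θ (m + 1) n = 2 / Real.cos θ * n * gram θ m (n - 1) +
      2 * (-Complex.I * Real.tan θ) * m * gram θ (m - 1) n := by
  have h1 := gram_succ_aux hθ m n
  have h2 := gram_succ_aux (θ := -θ) (by rwa [Real.cos_neg]) n m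
  rw [gram_neg, gram_neg, gram_neg, Real.cos_neg, Real.sin_neg] at h2
  rw [h2] at h1
  have hc : (Real.cos θ : ℂ) ≠ 0 := by exact_mod_cast hθ.ne'
  have hcs : (Real.sin θ : ℂ) ^ 2 + (Real.cos θ : ℂ) ^ 2 = 1 := by
    exact_mod_cast Real.sin_sq_add_cos_sq θ
  rw [Real.tan_eq_sin_div_cos]
  push_cast at h1 hc hcs ⊢
  field_simp
  apply mul_left_cancel₀ hc
  linear_combination h1 + gram θ (m + 1) n * hcs -
    Complex.sin θ ^ 2 * gram θ (m + 1) n * Complex.I_sq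

theorem gram_succ_right {θ : ℝ} (hθ : 0 < Real.cos θ) (m n : ℕ) :
    gram θ m (n + 1) = 2 / Real.cos θ * m * gram θ (m - 1) n +
      2 * (Complex.I * Real.tan θ) * n * gram θ m (n - 1) := by
  have h := gram_succ_left (θ := -θ) (by rwa [Real.cos_neg]) n m
  rw [gram_neg, gram_neg, gram_neg, Real.cos_neg, Real.tan_neg] at h
  rw [h]
  push_cast
  ring

/-- Behind this is the generating function Σ g(m,n) s^m t^n/(m! n!) = g(0,0) exp(αs² + γst + βt²),
with α = -i tan θ, γ = 2/cos θ, β = i tan θ; its part of degree 2N is the N-th power over N!. The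
induction matches the two recurrences. -/
theorem gram_eq_coeff {θ : ℝ} (hθ : 0 < Real.cos θ) (N m n : ℕ) (h : m + n = 2 * N) :
    N.factorial * gram θ m n = m.factorial * n.factorial * gram θ 0 0 *
      ((Polynomial.C (-Complex.I * Real.tan θ) * Polynomial.X ^ 2 + Polynomial.C (2 / Real.cos θ : ℂ) * Polynomial.X +
        Polynomial.C (Complex.I * Real.tan θ)) ^ N).coeff m := by
  set α : ℂ := -Complex.I * Real.tan θ with hα
  set β : ℂ := Complex.I * Real.tan θ with hβ
  set γ : ℂ := 2 / Real.cos θ with hγ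
  induction N generalizing m n with
  | zero =>
    obtain ⟨rfl, rfl⟩ : m = 0 ∧ n = 0 := by omega
    simp
  | succ N ih =>
    rcases m with _ | m
    · obtain ⟨n, rfl⟩ : ∃ k, n = k + 2 := ⟨n - 2, by omega⟩
      have h1 := gram_succ_right hθ 0 (n + 1)
      have h2 := ih 0 n (by omega)
      rw [coeff_quadratic_pow_zero] at h2 ⊢
      have h3 : (n : ℂ) = 2 * N := by
        have : n = 2 * N := by omega
        exact_mod_cast this
      simp only [Nat.add_sub_cancel] at h1
      rw [h1, ← hβ]
      simp only [Nat.factorial_succ, Nat.factorial_zero]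
      simp only [Nat.factorial_zero] at h2
      push_cast at h2 ⊢
      linear_combination 2 * β * (N + 1) * (n + 1) * h2 +
        β ^ (N + 1) * gram θ 0 0 * (n + 1) * n.factorial * (-h3)
    · have h1 := gram_succ_left hθ m n
      have h2 := coeff_quadratic_pow_succ α γ β N m
      rw [← hα, ← hγ] at h1
      set q := Polynomial.C α * Polynomial.X ^ 2 + Polynomial.C γ * Polynomial.X + Polynomial.C β with hq
      have h3 : (N.factorial : ℂ) * (n * gram θ m (n - 1)) =
          m.factorial * n.factorial * gram θ 0 0 * (q ^ N).coeff m := by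
        -- When n = 0 one has m = 2N + 1, beyond the degree of q^N, so both sides vanish.
        rcases n with _ | n
        · have hd : (q ^ N).natDegree ≤ N * 2 :=
            Polynomial.natDegree_pow_le_of_le N Polynomial.natDegree_quadratic_le
          rw [Polynomial.coeff_eq_zero_of_natDegree_lt (by omega)]
          simp
        · have := ih m n (by omega)
          simp only [Nat.add_sub_cancel, Nat.factorial_succ]
          push_cast
          linear_combination (n + 1) * this
      have h4 : (N.factorial : ℂ) * (m * gram θ (m - 1) n) =
          m.factorial * n.factorial * gram θ 0 0 *
            (if m = 0 then 0 else (q ^ N).coeff (m - 1)) := by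
        rcases m with _ | m
        · simp
        · have := ih m n (by omega)
          simp only [Nat.add_sub_cancel, Nat.factorial_succ, Nat.succ_ne_zero, if_false]
          push_cast
          linear_combination (m + 1) * this
      rw [h1]
      simp only [Nat.factorial_succ]
      push_cast
      linear_combination (N + 1) * γ * h3 + 2 * α * (N + 1) * h4 -
        m.factorial * n.factorial * gram θ 0 0 * h2

/-- The central coefficient sees only αβ = tan² θ = (1/cos θ)² - 1, which is the constant term of
the Legendre quadratic at x = 1/cos θ. -/
theorem gram_self {θ : ℝ} (hθ : 0 < Real.cos θ) (k : ℕ) :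
    gram θ k k = 2 ^ k * k.factorial * gram θ 0 0 *
      ((legendrePoly k).eval (1 / Real.cos θ) : ℝ) := by
  have h1 := gram_eq_coeff hθ k k k (by omega)
  have h2 := legendrePoly_eval k (1 / Real.cos θ)
  rw [centralCoeff_eq] at h1
  have h3 : Polynomial.X ^ 2 + Polynomial.C (2 / Real.cos θ : ℂ) * Polynomial.X +
      Polynomial.C (-Complex.I * Real.tan θ * (Complex.I * Real.tan θ)) =
      (Polynomial.X ^ 2 + Polynomial.C (2 * (1 / Real.cos θ)) * Polynomial.X +
        Polynomial.C ((1 / Real.cos θ) ^ 2 - 1)).map Complex.ofRealHom := by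
    have h4 : -Complex.I * Real.tan θ * (Complex.I * Real.tan θ) =
        (((1 / Real.cos θ) ^ 2 - 1 : ℝ) : ℂ) := by
      have h5 : Real.tan θ ^ 2 = (1 / Real.cos θ) ^ 2 - 1 := by
        rw [Real.tan_eq_sin_div_cos]
        field_simp
        linarith [Real.sin_sq_add_cos_sq θ]
      rw [← h5]
      push_cast
      linear_combination -(Complex.tan θ) ^ 2 * Complex.I_sq
    have h6 : (2 / Real.cos θ : ℂ) = ((2 * (1 / Real.cos θ) : ℝ) : ℂ) := by
      push_cast
      ring
    rw [h4, h6]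
    simp
  rw [h3, ← Polynomial.map_pow, Polynomial.coeff_map, ← h2] at h1
  have hk : (k.factorial : ℂ) ≠ 0 := by exact_mod_cast k.factorial_ne_zero
  apply mul_left_cancel₀ hk
  rw [h1]
  simp only [Complex.ofRealHom_eq_coe]
  push_cast
  ring

theorem bil_groundState {θ : ℝ} (hθ : 0 < Real.cos θ) :
    ‖bil (groundState θ) (groundState θ)‖ = Real.sqrt Real.pi := by
  have h1 : bil (groundState θ) (groundState θ) =
      ∫ x : ℝ, Complex.exp (-Complex.exp (Complex.I * θ) * (x : ℂ) ^ 2) := by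
    rw [bil_apply]
    congr 1
    ext x
    rw [groundState_apply hθ, ← Complex.exp_add]
    ring_nf
  rw [h1, integral_gaussian_complex (by rwa [re_exp_I_mul])]
  have h2 : (1 / 2 : ℂ) = ((1 / 2 : ℝ) : ℂ) := by push_cast; rfl
  rw [h2, Complex.norm_cpow_real, norm_div, mul_comm Complex.I, Complex.norm_exp_ofReal_mul_I,
    div_one, Complex.norm_real, Real.norm_of_nonneg Real.pi_pos.le, Real.sqrt_eq_rpow]

theorem gram_zero_zero {θ : ℝ} (hθ : 0 < Real.cos θ) :
    gram θ 0 0 = (Real.sqrt (Real.pi / Real.cos θ) : ℝ) := by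
  rw [← integral_gaussian, ← integral_complex_ofReal, gram, bil_apply]
  congr 1
  ext x
  rw [eigenfunction_zero, eigenfunction_zero, groundState_apply hθ,
    groundState_apply (by rwa [Real.cos_neg]), ← Complex.exp_add, Complex.ofReal_exp]
  congr 1
  push_cast
  rw [Complex.cos, mul_neg, mul_comm Complex.I, neg_mul]
  ring_nf

end RotatedOscillator

namespace RotatedOscillator

/-! ## Schwartz functions in `L²` and the graph of the oscillator -/

/-- The inclusion of the Schwartz space in `L²(ℝ)`. -/
def toL2 : 𝓢(ℝ, ℂ) →ₗ[ℂ] L2 := (SchwartzMap.toLpCLM ℂ ℂ 2 (volume : Measure ℝ)).toLinearMap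

theorem toL2_apply (u : 𝓢(ℝ, ℂ)) : toL2 u = u.toLp 2 := rfl

theorem toL2_injective : Function.Injective toL2 := SchwartzMap.injective_toLp 2 volume

theorem inner_toL2 (u v : 𝓢(ℝ, ℂ)) : inner ℂ (toL2 u) (toL2 v) = bil (conj u) v := by
  rw [toL2_apply, toL2_apply, SchwartzMap.inner_toL2_toL2_eq u v volume, bil_apply]
  simp [mul_comm]

theorem toDist_apply (f : L2) (u : 𝓢(ℝ, ℂ)) : toDist f u = ∫ x, u x * f x :=
  Lp.toTemperedDistribution_apply f u

theorem toDist_eq_inner (f : L2) (u : 𝓢(ℝ, ℂ)) :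
    toDist f u = inner ℂ (toL2 (conj u)) f := by
  rw [toDist_apply, L2.inner_def]
  refine integral_congr_ae ?_
  filter_upwards [(conj u).coeFn_toLp 2 volume] with x hx
  rw [toL2_apply, hx]
  simp [mul_comm]

theorem toDist_toL2 (u v : 𝓢(ℝ, ℂ)) : toDist (toL2 u) v = bil v u := by
  rw [toDist_eq_inner, inner_toL2, conj_conj]

/-- The two signs from the two distributional derivatives cancel, so the formal transpose is the
same expression. -/
theorem expression_apply (θ : ℝ) (T : 𝓢'(ℝ, ℂ)) (u : 𝓢(ℝ, ℂ)) :
    expression θ T u = T (schwartzOp θ u) := by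
  have h : (fun x : ℝ ↦ (x : ℂ)).HasTemperateGrowth :=
    Function.Complex.hasTemperateGrowth_ofReal
  have hX : SchwartzMap.smulLeftCLM ℂ (fun x : ℝ ↦ (x : ℂ) ^ 2) u = X (X u) := by
    ext x
    have h2 : (fun x : ℝ ↦ (x : ℂ) ^ 2).HasTemperateGrowth := h.pow 2
    rw [SchwartzMap.smulLeftCLM_apply_apply h2]
    simp
    ring
  have hD : SchwartzMap.derivCLM ℂ ℂ (SchwartzMap.derivCLM ℂ ℂ u) = D (D u) := rfl
  have : expression θ T u = -Complex.exp (-(Complex.I * θ)) • T (D (D u)) +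
      Complex.exp (Complex.I * θ) • T (X (X u)) := by
    rw [← hX, ← hD, ← neg_neg (SchwartzMap.derivCLM ℂ ℂ (SchwartzMap.derivCLM ℂ ℂ u)), ← map_neg]
    rfl
  rw [this, schwartzOp, map_add, map_smul, map_smul]

theorem mem_graph_iff (θ : ℝ) (p : L2 × L2) :
    p ∈ graph θ ↔ ∀ u, toDist p.1 (schwartzOp θ u) = toDist p.2 u := by
  have h : p ∈ graph θ ↔ expression θ (toDist p.1) = toDist p.2 := Iff.rfl
  rw [h]
  constructor
  · intro h u
    rw [← expression_apply, h]
  · intro h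
    ext u
    rw [expression_apply, h]

theorem toL2_mem_graph (θ : ℝ) (u : 𝓢(ℝ, ℂ)) :
    (toL2 u, toL2 (schwartzOp θ u)) ∈ graph θ := by
  rw [mem_graph_iff]
  intro v
  rw [toDist_toL2, toDist_toL2, bil_schwartzOp]

theorem isClosed_graph (θ : ℝ) : IsClosed (graph θ : Set (L2 × L2)) :=
  isClosed_eq ((expression θ).continuous.comp (toDist.continuous.comp continuous_fst))
    (toDist.continuous.comp continuous_snd)

/-! ## Completeness of the eigenfunctions -/

theorem memLp_exp_mul_groundState {θ : ℝ} (hθ : 0 < Real.cos θ) (M : ℝ) :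
    MemLp (fun x : ℝ ↦ Real.exp (M * |x|) * ‖groundState θ x‖) 2 volume := by
  set a : ℝ := Real.cos θ with ha
  have hb : 0 < ((a / 2 : ℝ) : ℂ).re := by rw [Complex.ofReal_re]; positivity
  have h1 : MemLp (gaussianSchwartz _ hb) 2 volume := (gaussianSchwartz _ hb).memLp 2
  -- Half of the Gaussian absorbs e^{M|x|} at the cost e^{M²/a}, by completing the square; the other
  -- half is still square integrable.
  refine (h1.norm.const_mul (Real.exp (M ^ 2 / a))).mono' ?_ (ae_of_all _ fun x ↦ ?_)
  · have := (groundState θ).continuous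
    exact Continuous.aestronglyMeasurable (by fun_prop)
  · have h2 : ‖gaussianSchwartz _ hb x‖ = Real.exp (-(a / 4 * x ^ 2)) := by
      refine (norm_exp_neg_mul_sq _ x).trans ?_
      rw [Complex.ofReal_re]
      ring_nf
    rw [Real.norm_of_nonneg (by positivity), groundState_apply hθ, norm_exp_neg_mul_sq,
      re_exp_I_mul, h2, ← Real.exp_add, ← Real.exp_add]
    refine Real.exp_le_exp.mpr ?_
    rw [← ha, ← sub_nonneg, ← sq_abs x]
    have : M ^ 2 / a + -(a / 4 * |x| ^ 2) - (M * |x| + -(a / 2 * |x| ^ 2)) =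
        (M - a * |x| / 2) ^ 2 / a := by
      field_simp
      ring
    rw [this]
    positivity

theorem integrable_exp_mul_groundState_mul {θ : ℝ} (hθ : 0 < Real.cos θ) (M : ℝ) (f : L2) :
    Integrable (fun x : ℝ ↦ Real.exp (M * |x|) * ‖groundState θ x * f x‖) volume := by
  have := (memLp_exp_mul_groundState hθ M).integrable_mul (Lp.memLp f).norm
  refine this.congr (ae_of_all _ fun x ↦ ?_)
  simp [mul_assoc]

/-- Multiplication by powers of the coordinate preserves the span of the eigenfunctions. -/
theorem X_iterate_groundState_mem_span {θ : ℝ} (hθ : 0 < Real.cos θ) (n : ℕ) :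
    X^[n] (groundState θ) ∈ Submodule.span ℂ (Set.range (eigenfunction θ)) := by
  induction n with
  | zero => exact Submodule.subset_span ⟨0, rfl⟩
  | succ n ih =>
    rw [Function.iterate_succ_apply']
    have h : Submodule.span ℂ (Set.range (eigenfunction θ)) ≤
        (Submodule.span ℂ (Set.range (eigenfunction θ))).comap X.toLinearMap := by
      rw [Submodule.span_le]
      rintro _ ⟨m, rfl⟩
      have : X (eigenfunction θ m) ∈ Submodule.span ℂ (Set.range (eigenfunction θ)) := by
        rw [X_eigenfunction hθ]
        exact Submodule.smul_mem _ _ (Submodule.add_mem _ (Submodule.subset_span ⟨_, rfl⟩)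
          (Submodule.smul_mem _ _ (Submodule.subset_span ⟨_, rfl⟩)))
      exact this
    exact h ih

theorem X_iterate_apply (n : ℕ) (u : 𝓢(ℝ, ℂ)) (x : ℝ) : X^[n] u x = (x : ℂ) ^ n * u x := by
  induction n with
  | zero => simp
  | succ n ih => rw [Function.iterate_succ_apply', X_apply, ih, pow_succ']; ring

theorem integral_pow_mul_eq_zero {θ : ℝ} (hθ : 0 < Real.cos θ) {f : L2}
    (hf : ∀ n, toDist f (eigenfunction θ n) = 0) (n : ℕ) :
    ∫ x : ℝ, (x : ℂ) ^ n * (groundState θ x * f x) = 0 := by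
  have h : Submodule.span ℂ (Set.range (eigenfunction θ)) ≤ (toDist f).toLinearMap.ker := by
    rw [Submodule.span_le]
    rintro _ ⟨m, rfl⟩
    exact hf m
  have h1 : toDist f (X^[n] (groundState θ)) = 0 := h (X_iterate_groundState_mem_span hθ n)
  rw [toDist_apply] at h1
  simpa [X_iterate_apply, mul_assoc] using h1

/-- All moments of φ_0 f vanish, and e^{‖z‖|x|} |φ_0 f| is integrable, so the exponential series may
be integrated term by term. -/
theorem integral_exp_mul_eq_zero {θ : ℝ} (hθ : 0 < Real.cos θ) {f : L2}
    (hf : ∀ n, toDist f (eigenfunction θ n) = 0) (z : ℂ) :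
    ∫ x : ℝ, Complex.exp (z * x) * (groundState θ x * f x) = 0 := by
  have hmeas : AEStronglyMeasurable (fun x ↦ groundState θ x * f x) volume :=
    (groundState θ).continuous.aestronglyMeasurable.mul (Lp.aestronglyMeasurable f)
  have hb (x : ℝ) : HasSum (fun n : ℕ ↦ (‖z‖ * |x|) ^ n / n.factorial *
      ‖groundState θ x * f x‖) (Real.exp (‖z‖ * |x|) * ‖groundState θ x * f x‖) := by
    rw [Real.exp_eq_exp_ℝ]
    exact (NormedSpace.expSeries_div_hasSum_exp (𝔸 := ℝ) (‖z‖ * |x|)).mul_right _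
  have h : HasSum (fun n : ℕ ↦ ∫ x : ℝ, (z * x) ^ n / n.factorial * (groundState θ x * f x))
      (∫ x : ℝ, Complex.exp (z * x) * (groundState θ x * f x)) := by
    refine hasSum_integral_of_dominated_convergence
      (fun n x ↦ (‖z‖ * |x|) ^ n / n.factorial * ‖groundState θ x * f x‖) (fun n ↦ ?_)
      (fun n ↦ ae_of_all _ fun x ↦ ?_) (ae_of_all _ fun x ↦ (hb x).summable) ?_
      (ae_of_all _ fun x ↦ ?_)
    · exact (Continuous.aestronglyMeasurable (by fun_prop)).mul hmeas
    · simp [mul_pow]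
    · simp only [(hb _).tsum_eq]
      exact integrable_exp_mul_groundState_mul hθ _ f
    · rw [Complex.exp_eq_exp_ℂ]
      exact (NormedSpace.expSeries_div_hasSum_exp (𝔸 := ℂ) (z * x)).mul_right _
  refine h.unique ?_
  convert! hasSum_zero using 2 with n
  have : ∀ x : ℝ, (z * x) ^ n / n.factorial * (groundState θ x * f x) =
      z ^ n / n.factorial * ((x : ℂ) ^ n * (groundState θ x * f x)) := fun x ↦ by ring
  simp only [this]
  rw [integral_const_mul, integral_pow_mul_eq_zero hθ hf, mul_zero]

end RotatedOscillator

open FourierTransform in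
/-- An integrable function with vanishing Fourier transform vanishes almost everywhere. -/
theorem ae_eq_zero_of_fourier_eq_zero {F : ℝ → ℂ} (hF : Integrable F) (h : 𝓕 F = 0) :
    ∀ᵐ x, F x = 0 := by
  refine ae_eq_zero_of_integral_contDiff_smul_eq_zero hF.locallyIntegrable fun g hg hg' ↦ ?_
  have hg₁ : HasCompactSupport (Complex.ofRealCLM ∘ g) := hg'.comp_left rfl
  have hg₂ : ContDiff ℝ (⊤ : ℕ∞) (Complex.ofRealCLM ∘ g) := by fun_prop
  set φ : 𝓢(ℝ, ℂ) := hg₁.toSchwartzMap hg₂ with hφ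
  have h1 : 𝓕 ((𝓕⁻ φ : 𝓢(ℝ, ℂ)) : ℝ → ℂ) = φ := by
    rw [← SchwartzMap.fourier_coe]
    simp
  -- Write the test function as a Fourier transform and move the transform onto F, where it
  -- vanishes.
  have h2 := VectorFourier.integral_fourierIntegral_smul_eq_flip (L := innerₗ ℝ)
    Real.continuous_fourierChar continuous_inner (𝓕⁻ φ : 𝓢(ℝ, ℂ)).integrable hF (μ := volume)
    (ν := volume)
  have h3 : VectorFourier.fourierIntegral Real.fourierChar volume (innerₗ ℝ).flip F = 0 := by
    rw [flip_innerₗ]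
    exact h
  have h4 : VectorFourier.fourierIntegral Real.fourierChar volume (innerₗ ℝ)
      ((𝓕⁻ φ : 𝓢(ℝ, ℂ)) : ℝ → ℂ) = φ := h1
  rw [h3, h4] at h2
  simpa [hφ] using h2

namespace RotatedOscillator

theorem groundState_ne_zero {θ : ℝ} (hθ : 0 < Real.cos θ) (x : ℝ) : groundState θ x ≠ 0 := by
  rw [groundState_apply hθ]
  exact Complex.exp_ne_zero _

/-- The eigenfunctions are complete: only `0` annihilates all of them. -/
theorem eq_zero_of_toDist_eigenfunction_eq_zero {θ : ℝ} (hθ : 0 < Real.cos θ) {f : L2}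
    (hf : ∀ n, toDist f (eigenfunction θ n) = 0) : f = 0 := by
  have hint : Integrable (fun x ↦ groundState θ x * f x) :=
    ((groundState θ).memLp 2).integrable_mul (Lp.memLp f)
  have h := ae_eq_zero_of_fourier_eq_zero hint (by
    ext w
    rw [Real.fourier_real_eq_integral_exp_smul]
    refine Eq.trans ?_ (integral_exp_mul_eq_zero hθ hf (-2 * Real.pi * w * Complex.I))
    congr 1
    ext x
    rw [smul_eq_mul]
    congr 2
    push_cast
    ring)
  rw [Lp.eq_zero_iff_ae_eq_zero]
  filter_upwards [h] with x hx
  simpa [groundState_ne_zero hθ] using hx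

theorem eq_zero_of_inner_eigenfunction_eq_zero {θ : ℝ} (hθ : 0 < Real.cos θ) {f : L2}
    (hf : ∀ n, inner ℂ (toL2 (eigenfunction θ n)) f = 0) : f = 0 := by
  have hθ' : 0 < Real.cos (-θ) := by rwa [Real.cos_neg]
  refine eq_zero_of_toDist_eigenfunction_eq_zero hθ' fun n ↦ ?_
  rw [toDist_eq_inner, conj_eigenfunction hθ', neg_neg, hf]

theorem dense_span_eigenfunction {θ : ℝ} (hθ : 0 < Real.cos θ) :
    (Submodule.span ℂ (Set.range fun n ↦ toL2 (eigenfunction θ n))).topologicalClosure = ⊤ := by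
  rw [Submodule.topologicalClosure_eq_top_iff, Submodule.eq_bot_iff]
  intro f hf
  refine eq_zero_of_inner_eigenfunction_eq_zero hθ fun n ↦ ?_
  exact (Submodule.mem_orthogonal _ _).mp hf _ (Submodule.subset_span ⟨n, rfl⟩)

end RotatedOscillator

namespace RotatedOscillator

/-! ## The energy estimate -/

theorem rot_zero : rot 0 = 1 := by simp [rot]

theorem conj_lower (c : ℂ) (u : 𝓢(ℝ, ℂ)) :
    conj (lower c u) = lower (starRingEnd ℂ c) (conj u) := by
  ext x
  have h := congrArg (fun v : 𝓢(ℝ, ℂ) ↦ v x) (conj_D u)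
  simp only [conj_apply] at h
  simp [lower_apply, h]

theorem bil_conj_self (u : 𝓢(ℝ, ℂ)) : bil (conj u) u = ((‖toL2 u‖ ^ 2 : ℝ) : ℂ) := by
  rw [← inner_toL2, inner_self_eq_norm_sq_to_K]
  push_cast
  rfl

/-- Integration by parts; e^{-iθ} and e^{iθ} have the same real part cos θ, which makes H coercive.
-/
theorem re_bil_conj_schwartzOp (θ : ℝ) (u : 𝓢(ℝ, ℂ)) :
    (bil (conj u) (schwartzOp θ u)).re =
      Real.cos θ * (‖toL2 (D u)‖ ^ 2 + ‖toL2 (X u)‖ ^ 2) := by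
  have h1 : bil (conj u) (D (D u)) = -((‖toL2 (D u)‖ ^ 2 : ℝ) : ℂ) := by
    rw [← bil_conj_self, conj_D, bil_D, neg_neg]
  have h2 : bil (conj u) (X (X u)) = ((‖toL2 (X u)‖ ^ 2 : ℝ) : ℂ) := by
    rw [← bil_conj_self, conj_X, bil_X]
  have h3 : (Complex.exp (-(Complex.I * θ))).re = Real.cos θ := by
    rw [← mul_neg, ← Complex.ofReal_neg, re_exp_I_mul, Real.cos_neg]
  rw [schwartzOp, map_add, map_smul, map_smul, h1, h2, smul_eq_mul, smul_eq_mul, neg_mul_neg,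
    Complex.add_re, Complex.re_mul_ofReal, Complex.re_mul_ofReal, h3, re_exp_I_mul]
  ring

/-- Evaluates the θ = 0 energy in two ways, directly and through the factorisation. -/
theorem norm_lower_sq (u : 𝓢(ℝ, ℂ)) :
    ‖toL2 (lower 1 u)‖ ^ 2 + ‖toL2 u‖ ^ 2 = ‖toL2 (D u)‖ ^ 2 + ‖toL2 (X u)‖ ^ 2 := by
  have h1 := re_bil_conj_schwartzOp 0 u
  have h2 := raise_lower_eq one_ne_zero (θ := 0) (by simp) u
  rw [eq_sub_iff_add_eq] at h2
  rw [← h2, map_add, bil_conj_self, bil_comm, bil_raise, bil_comm] at h1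
  have h3 : lower 1 (conj u) = conj (lower 1 u) := by rw [conj_lower, map_one]
  rw [h3, bil_conj_self, ← Complex.ofReal_add, Complex.ofReal_re] at h1
  simpa using h1

theorem energy_le (θ : ℝ) (u : 𝓢(ℝ, ℂ)) :
    Real.cos θ * (‖toL2 (lower 1 u)‖ ^ 2 + ‖toL2 u‖ ^ 2) ≤
      ‖toL2 u‖ * ‖toL2 (schwartzOp θ u)‖ := by
  rw [norm_lower_sq, ← re_bil_conj_schwartzOp, ← inner_toL2]
  exact (Complex.re_le_norm _).trans (norm_inner_le_norm _ _)

theorem norm_le_norm_schwartzOp {θ : ℝ} (hθ : 0 < Real.cos θ) (u : 𝓢(ℝ, ℂ)) :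
    ‖toL2 u‖ ≤ (Real.cos θ)⁻¹ * ‖toL2 (schwartzOp θ u)‖ := by
  have h := energy_le θ u
  rw [le_inv_mul_iff₀ hθ]
  rcases (norm_nonneg (toL2 u)).eq_or_lt with h0 | h0
  · rw [← h0, mul_zero]
    positivity
  · refine le_of_mul_le_mul_left ?_ h0
    nlinarith [mul_nonneg hθ.le (sq_nonneg ‖toL2 (lower 1 u)‖)]

theorem norm_lower_le_norm_schwartzOp {θ : ℝ} (hθ : 0 < Real.cos θ) (u : 𝓢(ℝ, ℂ)) :
    ‖toL2 (lower 1 u)‖ ≤ (Real.cos θ)⁻¹ * ‖toL2 (schwartzOp θ u)‖ := by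
  have h := energy_le θ u
  have h1 := norm_le_norm_schwartzOp hθ u
  rw [le_inv_mul_iff₀ hθ] at h1 ⊢
  refine le_of_sq_le_sq ?_ (norm_nonneg _)
  nlinarith [mul_le_mul_of_nonneg_right h1 (norm_nonneg (toL2 (schwartzOp θ u))),
    sq_nonneg (Real.cos θ * ‖toL2 u‖)]

/-! ## The Hermite basis -/

theorem inner_hermite (m n : ℕ) :
    inner ℂ (toL2 (eigenfunction 0 m)) (toL2 (eigenfunction 0 n)) =
      bil (eigenfunction 0 m) (eigenfunction 0 n) := by
  rw [inner_toL2, conj_eigenfunction (by simp), neg_zero]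

theorem norm_hermite_succ_sq (n : ℕ) : ‖toL2 (eigenfunction 0 (n + 1))‖ ^ 2 =
    2 * (n + 1) * ‖toL2 (eigenfunction 0 n)‖ ^ 2 := by
  have h0 : 0 < Real.cos 0 := by simp
  have h (k : ℕ) : ((‖toL2 (eigenfunction 0 k)‖ ^ 2 : ℝ) : ℂ) =
      2 ^ k * k.factorial * bil (groundState 0) (groundState 0) := by
    rw [← bil_eigenfunction_self h0, ← bil_conj_self, conj_eigenfunction h0, neg_zero]
  have : ((‖toL2 (eigenfunction 0 (n + 1))‖ ^ 2 : ℝ) : ℂ) =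
      ((2 * (n + 1) * ‖toL2 (eigenfunction 0 n)‖ ^ 2 : ℝ) : ℂ) := by
    rw [Complex.ofReal_mul, h, h, Nat.factorial_succ]
    push_cast
    ring
  exact_mod_cast this

theorem toL2_eigenfunction_ne_zero {θ : ℝ} (hθ : 0 < Real.cos θ) (n : ℕ) :
    toL2 (eigenfunction θ n) ≠ 0 := by
  intro h
  have h1 : eigenfunction θ n = 0 := toL2_injective (by rw [h, map_zero])
  have h2 := bil_eigenfunction_self hθ n
  rw [h1, map_zero, eq_comm, mul_eq_zero] at h2
  have h3 : (2 : ℂ) ^ n * n.factorial ≠ 0 :=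
    mul_ne_zero (pow_ne_zero _ two_ne_zero) (by exact_mod_cast n.factorial_ne_zero)
  have h4 := bil_groundState hθ
  rw [h2.resolve_left h3, norm_zero] at h4
  exact (Real.sqrt_pos.mpr Real.pi_pos).ne h4

/-- The normalised Hermite functions. -/
def hermite (n : ℕ) : L2 :=
  ((‖toL2 (eigenfunction 0 n)‖⁻¹ : ℝ) : ℂ) • toL2 (eigenfunction 0 n)

theorem orthonormal_hermite : Orthonormal ℂ hermite := by
  have h0 : 0 < Real.cos 0 := by simp
  constructor
  · intro n
    rw [hermite, norm_smul, Complex.norm_real, norm_inv, norm_norm,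
      inv_mul_cancel₀ (norm_ne_zero_iff.mpr (toL2_eigenfunction_ne_zero h0 n))]
  · intro m n h
    simp only [hermite]
    rw [inner_smul_left, inner_smul_right, inner_hermite, bil_eigenfunction_of_ne h0 h]
    rw [mul_zero, mul_zero]

theorem span_hermite : ⊤ ≤ (Submodule.span ℂ (Set.range hermite)).topologicalClosure := by
  have h0 : 0 < Real.cos 0 := by simp
  rw [← dense_span_eigenfunction h0]
  refine Submodule.topologicalClosure_mono ?_
  rw [Submodule.span_le]
  rintro _ ⟨n, rfl⟩
  have h1 : (‖toL2 (eigenfunction 0 n)‖ : ℂ) ≠ 0 := by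
    exact_mod_cast norm_ne_zero_iff.mpr (toL2_eigenfunction_ne_zero h0 n)
  have : toL2 (eigenfunction 0 n) = (‖toL2 (eigenfunction 0 n)‖ : ℂ) • hermite n := by
    rw [hermite, smul_smul, Complex.ofReal_inv, mul_inv_cancel₀ h1, one_smul]
  change toL2 (eigenfunction 0 n) ∈ _
  rw [this]
  exact Submodule.smul_mem _ _ (Submodule.subset_span ⟨n, rfl⟩)

/-- The Hilbert basis of Hermite functions. -/
def hermiteBasis : HilbertBasis ℕ ℂ L2 := HilbertBasis.mk orthonormal_hermite span_hermite

theorem hermiteBasis_apply (n : ℕ) : hermiteBasis n = hermite n := by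
  rw [hermiteBasis, HilbertBasis.coe_mk]

theorem norm_inner_hermite_succ_sq (n : ℕ) (u : 𝓢(ℝ, ℂ)) :
    2 * (n + 1) * ‖inner ℂ (hermite (n + 1)) (toL2 u)‖ ^ 2 =
      ‖inner ℂ (hermite n) (toL2 (lower 1 u))‖ ^ 2 := by
  have h0 : 0 < Real.cos 0 := by simp
  have h1 : inner ℂ (toL2 (eigenfunction 0 (n + 1))) (toL2 u) =
      inner ℂ (toL2 (eigenfunction 0 n)) (toL2 (lower 1 u)) := by
    rw [inner_toL2, inner_toL2, conj_eigenfunction h0, conj_eigenfunction h0, neg_zero,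
      eigenfunction_succ, bil_raise, rot_zero]
  have h2 := norm_hermite_succ_sq n
  have h3 : ‖toL2 (eigenfunction 0 n)‖ ≠ 0 :=
    norm_ne_zero_iff.mpr (toL2_eigenfunction_ne_zero h0 n)
  simp only [hermite, inner_smul_left, norm_mul, mul_pow, h1, RCLike.norm_conj, Complex.norm_real,
    norm_inv, norm_norm, inv_pow, h2]
  have : (n : ℝ) + 1 ≠ 0 := by positivity
  field_simp

/-- The orthogonal projection onto the first `n` Hermite functions. -/
def hermiteProj (n : ℕ) : L2 →L[ℂ] L2 :=
  ∑ k ∈ Finset.range n,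
    (ContinuousLinearMap.toSpanSingleton ℂ (hermite k)) ∘L innerSL ℂ (hermite k)

theorem hermiteProj_apply (n : ℕ) (f : L2) :
    hermiteProj n f = ∑ k ∈ Finset.range n, inner ℂ (hermite k) f • hermite k := by
  rw [hermiteProj, sum_apply]
  rfl

theorem isCompactOperator_hermiteProj (n : ℕ) : IsCompactOperator (hermiteProj n) := by
  refine (compactOperator (RingHom.id ℂ) L2 L2).sum_mem fun k _ ↦ ?_
  exact (isCompactOperator_of_locallyCompactSpace_rng
    (ContinuousLinearMap.toSpanSingleton ℂ (hermite k))).comp_clm (innerSL ℂ (hermite k))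

theorem hasSum_norm_inner_hermite_sq (f : L2) :
    HasSum (fun k ↦ ‖inner ℂ (hermite k) f‖ ^ 2) (‖f‖ ^ 2) := by
  have h := (hermiteBasis.hasSum_inner_mul_inner f f).mapL Complex.reCLM
  have h1 : Complex.reCLM (inner ℂ f f) = ‖f‖ ^ 2 := by
    rw [inner_self_eq_norm_sq_to_K]
    simp [← Complex.ofReal_pow]
  rw [h1] at h
  convert! h using 2 with k
  rw [hermiteBasis_apply, ← inner_conj_symm f, Complex.reCLM_apply, mul_comm, Complex.mul_conj,
    Complex.ofReal_re, Complex.normSq_eq_norm_sq]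

theorem norm_sub_hermiteProj_sq_le (n : ℕ) (u : 𝓢(ℝ, ℂ)) :
    ‖toL2 u - hermiteProj (n + 1) (toL2 u)‖ ^ 2 ≤
      1 / (2 * (n + 1)) * ‖toL2 (lower 1 u)‖ ^ 2 := by
  set w : L2 := toL2 u - hermiteProj (n + 1) (toL2 u) with hw
  have h1 (k : ℕ) : inner ℂ (hermite k) w =
      if k < n + 1 then 0 else inner ℂ (hermite k) (toL2 u) := by
    rw [hw, inner_sub_right, hermiteProj_apply]
    have := orthonormal_hermite.inner_right_sum (fun k ↦ inner ℂ (hermite k) (toL2 u))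
      (s := Finset.range (n + 1)) (i := k)
    split_ifs with h
    · rw [this (Finset.mem_range.mpr h), sub_self]
    · rw [inner_sum, Finset.sum_eq_zero, sub_zero]
      intro j hj
      rw [inner_smul_right, orthonormal_hermite.inner_eq_zero, mul_zero]
      rintro rfl
      exact h (Finset.mem_range.mp hj)
  have h2 := hasSum_norm_inner_hermite_sq w
  have h3 := (hasSum_norm_inner_hermite_sq (toL2 (lower 1 u))).mul_left (1 / (2 * ((n : ℝ) + 1)))
  -- The zeroth coefficient of w is 0, so the series can start at index 1, aligned with the
  -- coefficients of `lower 1 u`.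
  have h4 : HasSum (fun k ↦ ‖inner ℂ (hermite (k + 1)) w‖ ^ 2) (‖w‖ ^ 2) := by
    rw [← hasSum_nat_add_iff' 1] at h2
    simpa [h1 0] using h2
  refine hasSum_le (fun k ↦ ?_) h4 h3
  rw [h1, ← norm_inner_hermite_succ_sq]
  split_ifs with h
  · rw [norm_zero, zero_pow two_ne_zero]
    positivity
  · have h5 : (n : ℝ) ≤ k := by exact_mod_cast (by omega : n ≤ k)
    have h6 : 0 ≤ ‖inner ℂ (hermite (k + 1)) (toL2 u)‖ ^ 2 := by positivity
    rw [one_div, le_inv_mul_iff₀ (by positivity)]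
    nlinarith

/-! ## The compact inverse of the oscillator -/

/-- The differential expression as a linear map on the Schwartz space. -/
def schwartzOpLin (θ : ℝ) : 𝓢(ℝ, ℂ) →ₗ[ℂ] 𝓢(ℝ, ℂ) where
  toFun := schwartzOp θ
  map_add' u v := by
    simp only [schwartzOp, map_add, smul_add]
    abel
  map_smul' a u := by
    simp only [schwartzOp, map_smul, smul_add, RingHom.id_apply, smul_comm a]

theorem denseRange_schwartzOp {θ : ℝ} (hθ : 0 < Real.cos θ) :
    DenseRange (toL2 ∘ₗ schwartzOpLin θ) := by
  have h : Submodule.span ℂ (Set.range fun n ↦ toL2 (eigenfunction θ n)) ≤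
      (toL2 ∘ₗ schwartzOpLin θ).range := by
    rw [Submodule.span_le]
    rintro _ ⟨n, rfl⟩
    refine ⟨(2 * n + 1 : ℂ)⁻¹ • eigenfunction θ n, ?_⟩
    have h1 : schwartzOpLin θ (eigenfunction θ n) = (2 * n + 1 : ℂ) • eigenfunction θ n :=
      schwartzOp_eigenfunction hθ n
    have h2 : (2 * n + 1 : ℂ) ≠ 0 := by exact_mod_cast (2 * n).succ_ne_zero
    rw [LinearMap.comp_apply, map_smul, h1, smul_smul, inv_mul_cancel₀ h2, one_smul]
  have h1 := dense_span_eigenfunction hθ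
  rw [← Submodule.dense_iff_topologicalClosure_eq_top] at h1
  exact h1.mono h

/-- The energy bound extends the inverse continuously from a dense range. It also controls `lower 1
u`, hence the Hermite tails uniformly, so R is a norm limit of finite-rank operators. Closedness of
the graph carries HR = 1 to the limit. -/
theorem exists_compact_inverse {θ : ℝ} (hθ : 0 < Real.cos θ) :
    ∃ R : L2 →L[ℂ] L2, IsCompactOperator R ∧ ∀ f, (R f, f) ∈ graph θ := by
  set e := toL2 ∘ₗ schwartzOpLin θ with he
  have hd : DenseRange e := denseRange_schwartzOp hθ
  have hn : ∀ u, ‖toL2 u‖ ≤ (Real.cos θ)⁻¹ * ‖e u‖ := norm_le_norm_schwartzOp hθ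
  set R : L2 →L[ℂ] L2 := toL2.extendOfNorm e with hR
  have hRe (u : 𝓢(ℝ, ℂ)) : R (e u) = toL2 u := LinearMap.extendOfNorm_eq hd ⟨_, hn⟩ u
  refine ⟨R, ?_, fun f ↦ ?_⟩
  · have h1 (n : ℕ) (f : L2) : ‖(R - hermiteProj (n + 1) ∘L R) f‖ ≤
        Real.sqrt (1 / (2 * (n + 1))) * (Real.cos θ)⁻¹ * ‖f‖ := by
      refine hd.induction_on f (isClosed_le (by fun_prop) (by fun_prop)) fun u ↦ ?_
      have h2 := norm_sub_hermiteProj_sq_le n u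
      have h3 : ‖toL2 (lower 1 u)‖ ≤ (Real.cos θ)⁻¹ * ‖e u‖ := norm_lower_le_norm_schwartzOp hθ u
      rw [sub_apply, ContinuousLinearMap.comp_apply, hRe, mul_assoc]
      refine (Real.le_sqrt (norm_nonneg _) (by positivity)).mpr h2 |>.trans ?_
      rw [Real.sqrt_mul (by positivity), Real.sqrt_sq (norm_nonneg _)]
      gcongr
    have h2 (n : ℕ) : ‖R - hermiteProj (n + 1) ∘L R‖ ≤
        Real.sqrt (1 / (2 * (n + 1))) * (Real.cos θ)⁻¹ :=
      ContinuousLinearMap.opNorm_le_bound _ (by positivity) (h1 n)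
    have h3 : Tendsto (fun n : ℕ ↦ Real.sqrt (1 / (2 * ((n : ℝ) + 1))) * (Real.cos θ)⁻¹) atTop
        (𝓝 0) := by
      have h4 : Tendsto (fun n : ℕ ↦ 1 / (2 * ((n : ℝ) + 1))) atTop (𝓝 0) := by
        have := (tendsto_one_div_add_atTop_nhds_zero_nat (𝕜 := ℝ)).const_mul (1 / 2)
        rw [mul_zero] at this
        refine this.congr fun n ↦ ?_
        field_simp
      have h5 := ((Real.continuous_sqrt.tendsto 0).comp h4).mul_const (Real.cos θ)⁻¹
      simpa using h5
    have h4 : Tendsto (fun n : ℕ ↦ hermiteProj (n + 1) ∘L R) atTop (𝓝 R) := by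
      rw [tendsto_iff_norm_sub_tendsto_zero]
      refine squeeze_zero (fun n ↦ norm_nonneg _) (fun n ↦ ?_) h3
      rw [norm_sub_rev]
      exact h2 n
    exact isCompactOperator_of_tendsto h4 (Eventually.of_forall fun n ↦
      (isCompactOperator_hermiteProj (n + 1)).comp_clm R)
  · refine hd.induction_on f ?_ fun u ↦ ?_
    · exact (isClosed_graph θ).preimage (R.continuous.prodMk continuous_id)
    · rw [hRe]
      exact toL2_mem_graph θ u

end RotatedOscillator

/-! ## Operators with compact inverse and complete eigenvectors -/

namespace UnboundedOp

variable {E : Type*} [NormedAddCommGroup E] [NormedSpace ℂ E]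

theorem IsResolventAt.resolvent_eq {T : E →ₗ.[ℂ] E} {z : ℂ} {R : E →L[ℂ] E}
    (h : IsResolventAt T z R) : resolvent T z = R := by
  have h' : ∃ R : E →L[ℂ] E, IsResolventAt T z R := ⟨R, h⟩
  rw [resolvent, dif_pos h']
  exact h'.choose_spec.unique h

theorem IsResolventAt.apply_of_mem_graph {T : E →ₗ.[ℂ] E} {z w : ℂ} {R : E →L[ℂ] E}
    (h : IsResolventAt T z R) {u : E} (hu : (u, w • u) ∈ T.graph) : (w - z) • R u = u := by
  obtain ⟨v, hv, hTv⟩ := (LinearPMap.mem_graph_iff T).mp hu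
  have h1 := h.2 v
  rw [hTv, hv, ← sub_smul, map_smul] at h1
  exact h1

theorem hasEigenvalue_of_mem_graph {T : E →ₗ.[ℂ] E} {z : ℂ} {u : E} (h0 : u ≠ 0)
    (hu : (u, z • u) ∈ T.graph) : HasEigenvalue T z := by
  obtain ⟨v, hv, hTv⟩ := (LinearPMap.mem_graph_iff T).mp hu
  exact ⟨v, hv ▸ h0, by rw [hTv, hv]⟩

theorem notMem_resolventSet_of_mem_graph {T : E →ₗ.[ℂ] E} {z : ℂ} {u : E} (h0 : u ≠ 0)
    (hu : (u, z • u) ∈ T.graph) : z ∉ resolventSet T := by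
  rintro ⟨R, hR⟩
  have := hR.apply_of_mem_graph hu
  rw [sub_self, zero_smul] at this
  exact h0 this.symm

variable [CompleteSpace E]

/-- The Fredholm alternative: if z⁻¹ is not in the resolvent set of R, it is an eigenvalue of R,
which gives an eigenvector of T at z. -/
theorem isUnit_one_sub_smul {T : E →ₗ.[ℂ] E} {R : E →L[ℂ] E} (hc : IsCompactOperator R)
    (hR : ∀ f, (R f, f) ∈ T.graph) {z : ℂ} (hz : ∀ u, (u, z • u) ∈ T.graph → u = 0) :
    IsUnit (1 - z • R) := by
  rcases eq_or_ne z 0 with rfl | h0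
  · simp
  have h1 : z⁻¹ ∈ _root_.resolventSet ℂ R := by
    refine (hc.hasEigenvalue_or_mem_resolventSet (inv_ne_zero h0)).resolve_left fun h ↦ ?_
    obtain ⟨u, hu⟩ := h.exists_hasEigenvector
    have hu1 : R u = z⁻¹ • u := hu.apply_eq_smul
    have hu2 := T.graph.smul_mem z (hR u)
    rw [Prod.smul_mk, hu1, smul_smul, mul_inv_cancel₀ h0, one_smul] at hu2
    exact hu.2 (hz u hu2)
  rw [spectrum.mem_resolventSet_iff] at h1
  have h2 : 1 - z • R = (Units.mk0 z h0) • (algebraMap ℂ (E →L[ℂ] E) z⁻¹ - R) := by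
    rw [Units.smul_def, Units.val_mk0, smul_sub, Algebra.algebraMap_eq_smul_one, smul_smul,
      mul_inv_cancel₀ h0, one_smul]
  rw [h2]
  exact h1.smul _

theorem isResolventAt_of_compact_inverse {T : E →ₗ.[ℂ] E} {R : E →L[ℂ] E}
    (hc : IsCompactOperator R) (hR : ∀ f, (R f, f) ∈ T.graph) {z : ℂ}
    (hz : ∀ u, (u, z • u) ∈ T.graph → u = 0) :
    IsResolventAt T z (R * Ring.inverse (1 - z • R)) := by
  have hu := isUnit_one_sub_smul hc hR hz
  set S := Ring.inverse (1 - z • R) with hS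
  have h1 (f : E) : S f - z • R (S f) = f :=
    congrArg (fun A : E →L[ℂ] E ↦ A f) (Ring.mul_inverse_cancel _ hu)
  refine ⟨fun f ↦ ?_, fun u ↦ ?_⟩
  · obtain ⟨v, hv, hTv⟩ := (LinearPMap.mem_graph_iff T).mp (hR (S f))
    exact ⟨v, hv, by rw [hTv, hv]; exact h1 f⟩
  · obtain ⟨g, hg⟩ : ∃ g, g = T u - z • (u : E) := ⟨_, rfl⟩
    rw [← hg]
    -- The difference R(Sg) - u lies in the kernel of T - z, hence is 0; this is the left-inverse
    -- half.
    have h2 := T.graph.sub_mem (hR (S g)) (T.mem_graph u)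
    rw [Prod.mk_sub_mk] at h2
    have h3 : S g - T u = z • (R (S g) - u) := by
      linear_combination (norm := module) h1 g + hg
    rw [h3] at h2
    exact sub_eq_zero.mp (hz _ h2)

theorem isSpectralProjection_of_complete {T : E →ₗ.[ℂ] E} {R : E →L[ℂ] E}
    (hc : IsCompactOperator R) (hR : ∀ f, (R f, f) ∈ T.graph) {φ : ℕ → E} {lam : ℕ → ℂ}
    (hφ : ∀ k, (φ k, lam k • φ k) ∈ T.graph) (hφ0 : ∀ k, φ k ≠ 0)
    (hinj : ∀ z, z ∉ Set.range lam → ∀ u, (u, z • u) ∈ T.graph → u = 0)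
    (hd : Dense (Submodule.span ℂ (Set.range φ) : Set E)) {k : ℕ}
    (hiso : ∃ r : ℝ, 0 < r ∧ ∀ j, lam j ∈ Metric.closedBall (lam k) r → j = k)
    {P : E →L[ℂ] E} (hPk : P (φ k) = φ k) (hP : ∀ j, j ≠ k → P (φ j) = 0) :
    IsSpectralProjection T (lam k) P := by
  have hres {z : ℂ} (hz : z ∉ Set.range lam) := isResolventAt_of_compact_inverse hc hR (hinj z hz)
  have hnot (j : ℕ) : lam j ∉ resolventSet T := notMem_resolventSet_of_mem_graph (hφ0 j) (hφ j)
  refine ⟨hnot k, ?_, fun r hr hsub ↦ ?_⟩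
  · obtain ⟨r, hr, hr'⟩ := hiso
    refine ⟨r, hr, ?_⟩
    rintro z ⟨hz, hzk⟩
    refine ⟨_, hres ?_⟩
    rintro ⟨j, rfl⟩
    rw [hr' j hz] at hzk
    exact hzk rfl
  have hk : ∀ j, j ≠ k → lam j ≠ lam k := by
    obtain ⟨r', hr', hr''⟩ := hiso
    intro j hj h
    exact hj (hr'' j (by rw [h]; exact Metric.mem_closedBall_self hr'.le))
  -- The radius is any admissible one: eigenvalues never lie in the resolvent set, so none but the
  -- centre is in the disc.
  have hball : ∀ j, j ≠ k → lam j ∉ Metric.closedBall (lam k) r := fun j hj hmem ↦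
    hnot j (hsub ⟨hmem, hk j hj⟩)
  have hsph : ∀ z ∈ Metric.sphere (lam k) r, z ∉ Set.range lam := by
    rintro z hz ⟨j, rfl⟩
    refine hnot j (hsub ⟨Metric.sphere_subset_closedBall hz, ?_⟩)
    rintro h
    rw [Set.mem_singleton_iff.mp h, Metric.mem_sphere, dist_self] at hz
    exact hr.ne hz
  have hcont : ContinuousOn (resolvent T) (Metric.sphere (lam k) r) := by
    have : ContinuousOn (fun z : ℂ ↦ R * Ring.inverse (1 - z • R)) (Metric.sphere (lam k) r) := by
      intro z hz
      obtain ⟨v, hv⟩ := isUnit_one_sub_smul hc hR (hinj z (hsph z hz))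
      have h1 := NormedRing.inverse_continuousAt v
      rw [hv] at h1
      have h2 : ContinuousAt (fun z : ℂ ↦ 1 - z • R) z := by fun_prop
      exact (continuousAt_const.mul (ContinuousAt.comp (f := fun z : ℂ ↦ 1 - z • R) h1
        h2)).continuousWithinAt
    exact this.congr fun z hz ↦ (hres (hsph z hz)).resolvent_eq
  -- On φ_j the resolvent is the scalar (λ_j - z)⁻¹, so Cauchy's theorem decides between φ_k and 0.
  refine ContinuousLinearMap.ext_on hd ?_
  rintro _ ⟨j, rfl⟩
  have h1 : circleIntegral (resolvent T) (lam k) r (φ j) =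
      circleIntegral (fun z ↦ resolvent T z (φ j)) (lam k) r := by
    have := (ContinuousLinearMap.apply ℂ E (φ j)).intervalIntegral_comp_comm
      (hcont.circleIntegrable hr.le).out
    exact this.symm
  have h2 : circleIntegral (fun z ↦ resolvent T z (φ j)) (lam k) r =
      (-circleIntegral (fun z ↦ (z - lam j)⁻¹) (lam k) r) • φ j := by
    rw [neg_smul, ← circleIntegral.integral_smul_const, ← neg_one_smul ℂ,
      ← circleIntegral.integral_smul]
    refine circleIntegral.integral_congr hr.le fun z hz ↦ ?_
    have h3 := (hres (hsph z hz)).apply_of_mem_graph (hφ j)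
    have h4 : z - lam j ≠ 0 := by
      rw [sub_ne_zero]
      rintro rfl
      exact hsph _ hz ⟨j, rfl⟩
    rw [(hres (hsph z hz)).resolvent_eq]
    nth_rw 2 [← h3]
    rw [smul_smul, smul_smul, ← neg_sub z, mul_neg, neg_one_mul, neg_mul, neg_neg,
      inv_mul_cancel₀ h4, one_smul]
  rw [contourProjection, smul_apply, h1, h2, smul_smul]
  rcases eq_or_ne j k with rfl | hj
  · rw [hPk, circleIntegral.integral_sub_inv_of_mem_ball (Metric.mem_ball_self hr), neg_mul_neg,
      inv_mul_cancel₀ Complex.two_pi_I_ne_zero, one_smul]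
  · have h3 : circleIntegral (fun z ↦ (z - lam j)⁻¹) (lam k) r = 0 := by
      have hd (z : ℂ) (hz : z ∈ Metric.closedBall (lam k) r) :
          DifferentiableAt ℂ (fun z ↦ (z - lam j)⁻¹) z := by
        refine DifferentiableAt.inv (by fun_prop) (sub_ne_zero.mpr ?_)
        rintro rfl
        exact hball j hj hz
      exact Complex.circleIntegral_eq_zero_of_differentiable_on_off_countable hr.le
        Set.countable_empty (fun z hz ↦ (hd z hz).continuousAt.continuousWithinAt)
        fun z hz ↦ hd z (Metric.ball_subset_closedBall hz.1)
    rw [hP j hj, h3, neg_zero, mul_zero, zero_smul]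

end UnboundedOp

/-! ## The spectral projections of the rotated oscillator -/

namespace RotatedOscillator

/-- The rank-one projection onto the `k`-th eigenfunction along the closed span of the others. -/
def eigenProjection (θ : ℝ) (k : ℕ) : L2 →L[ℂ] L2 :=
  (bil (eigenfunction θ k) (eigenfunction θ k))⁻¹ •
    InnerProductSpace.rankOne ℂ (toL2 (eigenfunction θ k)) (toL2 (eigenfunction (-θ) k))

theorem bil_eigenfunction_self_ne_zero {θ : ℝ} (hθ : 0 < Real.cos θ) (k : ℕ) :
    bil (eigenfunction θ k) (eigenfunction θ k) ≠ 0 := by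
  have h : bil (groundState θ) (groundState θ) ≠ 0 := by
    rw [← norm_ne_zero_iff, bil_groundState hθ]
    exact (Real.sqrt_pos.mpr Real.pi_pos).ne'
  rw [bil_eigenfunction_self hθ]
  exact mul_ne_zero (mul_ne_zero (pow_ne_zero _ two_ne_zero)
    (by exact_mod_cast k.factorial_ne_zero)) h

theorem eigenProjection_eigenfunction {θ : ℝ} (hθ : 0 < Real.cos θ) (k j : ℕ) :
    eigenProjection θ k (toL2 (eigenfunction θ j)) =
      ((bil (eigenfunction θ k) (eigenfunction θ k))⁻¹ *
        bil (eigenfunction θ k) (eigenfunction θ j)) • toL2 (eigenfunction θ k) := by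
  rw [eigenProjection, smul_apply, InnerProductSpace.rankOne_apply, smul_smul, inner_toL2,
    conj_eigenfunction (by rwa [Real.cos_neg]), neg_neg]

theorem eigenfunction_mem_graph {θ : ℝ} (hθ : 0 < Real.cos θ) (k : ℕ) :
    (toL2 (eigenfunction θ k), (2 * (k : ℂ) + 1) • toL2 (eigenfunction θ k)) ∈ (H θ).graph := by
  rw [H_graph, ← map_smul, ← schwartzOp_eigenfunction hθ]
  exact toL2_mem_graph θ _

theorem hasEigenvalue {θ : ℝ} (hθ : 0 < Real.cos θ) (k : ℕ) :
    UnboundedOp.HasEigenvalue (H θ) (2 * (k : ℂ) + 1) :=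
  UnboundedOp.hasEigenvalue_of_mem_graph (toL2_eigenfunction_ne_zero hθ k)
    (eigenfunction_mem_graph hθ k)

theorem isSpectralProjection_eigenProjection {θ : ℝ} (hθ : 0 < Real.cos θ) (k : ℕ) :
    UnboundedOp.IsSpectralProjection (H θ) (2 * (k : ℂ) + 1) (eigenProjection θ k) := by
  obtain ⟨R, hc, hR⟩ := exists_compact_inverse hθ
  rw [← H_graph] at hR
  refine UnboundedOp.isSpectralProjection_of_complete hc hR
    (φ := fun n ↦ toL2 (eigenfunction θ n)) (lam := fun n ↦ 2 * (n : ℂ) + 1)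
    (eigenfunction_mem_graph hθ) (toL2_eigenfunction_ne_zero hθ) (fun z hz u hu ↦ ?_)
    ?_ ⟨1, one_pos, fun j hj ↦ ?_⟩ ?_ fun j hj ↦ ?_
  -- An eigenvector u in the maximal domain, tested against φ_n, gives (2n + 1 - z)⟨u, φ_n⟩ = 0;
  -- completeness forces u = 0.
  · rw [H_graph, mem_graph_iff] at hu
    refine eq_zero_of_toDist_eigenfunction_eq_zero hθ fun n ↦ ?_
    have h := hu (eigenfunction θ n)
    rw [schwartzOp_eigenfunction hθ] at h
    have h1 : (2 * (n : ℂ) + 1 - z) * toDist u (eigenfunction θ n) = 0 := by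
      rw [sub_mul, sub_eq_zero, ← smul_eq_mul, ← map_smul, h, map_smul]
      rfl
    refine (mul_eq_zero.mp h1).resolve_left fun h2 ↦ hz ⟨n, sub_eq_zero.mp h2⟩
  · exact Submodule.dense_iff_topologicalClosure_eq_top.mpr (dense_span_eigenfunction hθ)
  · rw [Metric.mem_closedBall, dist_eq_norm] at hj
    have h1 : (2 * (j : ℂ) + 1 - (2 * (k : ℂ) + 1)) = ((2 * ((j : ℤ) - k) : ℤ) : ℂ) := by
      push_cast
      ring
    rw [h1, Complex.norm_intCast] at hj
    have h2 : |2 * ((j : ℤ) - k)| ≤ 1 := by exact_mod_cast hj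
    rw [abs_le] at h2
    omega
  · rw [eigenProjection_eigenfunction hθ, inv_mul_cancel₀ (bil_eigenfunction_self_ne_zero hθ k),
      one_smul]
  · rw [eigenProjection_eigenfunction hθ, bil_eigenfunction_of_ne hθ hj.symm, mul_zero, zero_smul]

/-- A rank-one operator has norm the product of the norms of its two vectors; here they are complex
conjugates, so the product is the Gram entry at (k, k). -/
theorem norm_eigenProjection {θ : ℝ} (hθ : 0 < Real.cos θ) (k : ℕ) :
    ‖eigenProjection θ k‖ = (Real.cos θ) ^ (-(1 / 2) : ℝ) *
      (legendrePoly k).eval (1 / Real.cos θ) := by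
  have hθ' : 0 < Real.cos (-θ) := by rwa [Real.cos_neg]
  have h1 : ((‖toL2 (eigenfunction θ k)‖ ^ 2 : ℝ) : ℂ) = gram θ k k := by
    rw [← bil_conj_self, conj_eigenfunction hθ, gram]
  have h2 : ((‖toL2 (eigenfunction (-θ) k)‖ ^ 2 : ℝ) : ℂ) = gram θ k k := by
    rw [← bil_conj_self, conj_eigenfunction hθ', neg_neg, bil_comm, gram]
  have h3 : ‖toL2 (eigenfunction (-θ) k)‖ = ‖toL2 (eigenfunction θ k)‖ := by
    rw [← h1] at h2
    exact (pow_left_inj₀ (norm_nonneg _) (norm_nonneg _) two_ne_zero).mp (by exact_mod_cast h2)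
  have h4 : ‖toL2 (eigenfunction θ k)‖ ^ 2 = 2 ^ k * k.factorial *
      Real.sqrt (Real.pi / Real.cos θ) * (legendrePoly k).eval (1 / Real.cos θ) := by
    rw [gram_self hθ, gram_zero_zero hθ] at h1
    exact_mod_cast h1
  rw [eigenProjection, norm_smul, InnerProductSpace.norm_rankOne, h3, ← pow_two, h4, norm_inv,
    bil_eigenfunction_self hθ, norm_mul, bil_groundState hθ, norm_mul, norm_pow, Complex.norm_natCast,
    Complex.norm_ofNat, Real.sqrt_div Real.pi_pos.le, Real.rpow_neg hθ.le,
    ← Real.sqrt_eq_rpow]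
  have h5 : Real.sqrt Real.pi ≠ 0 := (Real.sqrt_pos.mpr Real.pi_pos).ne'
  have h6 : (k.factorial : ℝ) ≠ 0 := by exact_mod_cast k.factorial_ne_zero
  field_simp

end RotatedOscillator

/-! ## Laplace's integral and the asymptotics of Legendre polynomials -/

theorem integral_exp_int_mul_I (n : ℤ) :
    ∫ t in (-Real.pi)..Real.pi, Complex.exp (n * Complex.I * t) =
      if n = 0 then 2 * (Real.pi : ℂ) else 0 := by
  split_ifs with h
  · subst h
    simp
    ring
  · have h1 : (n : ℂ) * Complex.I ≠ 0 := mul_ne_zero (by exact_mod_cast h) Complex.I_ne_zero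
    rw [integral_exp_mul_complex h1]
    have h2 : Complex.exp (n * Complex.I * (Real.pi : ℝ)) =
        Complex.exp (n * Complex.I * (-Real.pi : ℝ)) := by
      rw [Complex.exp_eq_exp_iff_exists_int]
      refine ⟨n, ?_⟩
      push_cast
      ring
    rw [h2, sub_self, zero_div]

/-- Coefficient extraction by integration over the unit circle. -/
theorem integral_eval_exp_mul_exp (p : Polynomial ℂ) (k : ℕ) :
    ∫ t in (-Real.pi)..Real.pi, p.eval (Complex.exp (Complex.I * t)) *
      Complex.exp (-(k * (Complex.I * t))) = 2 * Real.pi * p.coeff k := by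
  induction p using Polynomial.induction_on' with
  | add p q hp hq =>
    simp only [Polynomial.eval_add, add_mul, Polynomial.coeff_add, mul_add]
    rw [intervalIntegral.integral_add, hp, hq]
    · exact Continuous.intervalIntegrable (by fun_prop) _ _
    · exact Continuous.intervalIntegrable (by fun_prop) _ _
  | monomial n a =>
    have h (t : ℝ) : (Polynomial.monomial n a).eval (Complex.exp (Complex.I * t)) *
        Complex.exp (-(k * (Complex.I * t))) =
        a * Complex.exp (((n - k : ℤ) : ℂ) * Complex.I * t) := by
      rw [Polynomial.eval_monomial, mul_assoc, ← Complex.exp_nat_mul, ← Complex.exp_add]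
      congr 2
      push_cast
      ring
    simp only [h]
    rw [intervalIntegral.integral_const_mul, integral_exp_int_mul_I, Polynomial.coeff_monomial]
    have : (n : ℤ) - k = 0 ↔ n = k := by omega
    simp only [this]
    split_ifs <;> ring

/-- Laplace's integral for the Legendre polynomials. -/
theorem legendrePoly_eval_eq_integral {x y : ℝ} (h : y ^ 2 = x ^ 2 - 1) (k : ℕ) :
    2 * Real.pi * (legendrePoly k).eval x =
      ∫ t in (-Real.pi)..Real.pi, (x + y * Real.cos t) ^ k := by
  -- Splitting the constant x² - 1 = y² evenly keeps the central coefficient and makes e^{-it}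
  -- q(e^{it}) = 2(x + y cos t) real.
  set q : Polynomial ℝ := Polynomial.C y * Polynomial.X ^ 2 + Polynomial.C (2 * x) * Polynomial.X +
    Polynomial.C y with hq
  have h1 : 2 ^ k * (legendrePoly k).eval x = (q ^ k).coeff k := by
    rw [legendrePoly_eval, hq, centralCoeff_eq, ← h, pow_two y]
  have h2 := integral_eval_exp_mul_exp ((q ^ k).map Complex.ofRealHom) k
  have h3 (t : ℝ) : ((q ^ k).map Complex.ofRealHom).eval (Complex.exp (Complex.I * t)) *
      Complex.exp (-(k * (Complex.I * t))) = ((2 ^ k * (x + y * Real.cos t) ^ k : ℝ) : ℂ) := by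
    rw [Polynomial.map_pow, Polynomial.eval_pow, ← mul_neg, Complex.exp_nat_mul, ← mul_pow,
      ← mul_pow]
    push_cast
    congr 1
    have he := Complex.exp_ne_zero (Complex.I * t)
    simp only [hq, Polynomial.map_add, Polynomial.map_mul, Polynomial.map_pow, Polynomial.map_C,
      Polynomial.map_X, Polynomial.eval_add, Polynomial.eval_mul, Polynomial.eval_pow,
      Polynomial.eval_C, Polynomial.eval_X, Complex.ofRealHom_eq_coe]
    rw [Complex.cos, show -(t : ℂ) * Complex.I = -(Complex.I * t) by ring,
      show (t : ℂ) * Complex.I = Complex.I * t by ring, Complex.exp_neg]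
    push_cast
    field_simp
    ring
  simp only [h3] at h2
  rw [intervalIntegral.integral_ofReal, Polynomial.coeff_map, ← h1,
    intervalIntegral.integral_const_mul] at h2
  have h4 : (2 : ℝ) ^ k * ∫ t in (-Real.pi)..Real.pi, (x + y * Real.cos t) ^ k =
      2 * Real.pi * (2 ^ k * (legendrePoly k).eval x) := by
    rw [Complex.ofRealHom_eq_coe] at h2
    exact_mod_cast h2
  apply mul_left_cancel₀ (pow_ne_zero k (two_ne_zero (α := ℝ)))
  rw [h4]
  ring

/-! ### Laplace's method -/

theorem tendsto_mul_one_sub_cos (u : ℝ) :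
    Tendsto (fun k : ℕ ↦ (k : ℝ) * (1 - Real.cos (u / Real.sqrt k))) atTop (𝓝 (u ^ 2 / 2)) := by
  have h1 : Tendsto (fun k : ℕ ↦ u / 2 / Real.sqrt k) atTop (𝓝 0) :=
    (Real.tendsto_sqrt_atTop.comp tendsto_natCast_atTop_atTop).const_div_atTop _
  have h2 := (((Real.continuous_sinc.tendsto 0).comp h1).pow 2).const_mul (u ^ 2 / 2)
  rw [Real.sinc_zero, one_pow, mul_one] at h2
  refine h2.congr' ?_
  filter_upwards [eventually_gt_atTop 0] with k hk
  have hk' : (0 : ℝ) < k := by exact_mod_cast hk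
  have hs := Real.sqrt_pos.mpr hk'
  rcases eq_or_ne u 0 with rfl | hu
  · simp
  have h3 : u / 2 / Real.sqrt k ≠ 0 := by positivity
  have h4 : u / Real.sqrt k = 2 * (u / 2 / Real.sqrt k) := by ring
  simp only [Function.comp_apply]
  rw [Real.sinc_of_ne_zero h3, h4, Real.cos_two_mul, Real.cos_sq']
  have h5 : (k : ℝ) = Real.sqrt k ^ 2 := (Real.sq_sqrt hk'.le).symm
  field_simp
  rw [← h5]
  ring

/-- Substituting t = u/√k turns the integrand into one tending to exp(-pu²/2), to which dominated
convergence applies. The condition p ≤ 1/2 keeps the base nonnegative. -/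
theorem tendsto_sqrt_mul_integral_pow {p : ℝ} (hp : 0 < p) (hp' : p ≤ 1 / 2) :
    Tendsto (fun k : ℕ ↦ Real.sqrt k *
      ∫ t in (-Real.pi)..Real.pi, (1 - p * (1 - Real.cos t)) ^ k) atTop
      (𝓝 (Real.sqrt (2 * Real.pi / p))) := by
  have hg : ∫ u : ℝ, Real.exp (-(p / 2) * u ^ 2) = Real.sqrt (2 * Real.pi / p) := by
    rw [integral_gaussian]
    congr 1
    field_simp
  rw [← hg]
  set F : ℕ → ℝ → ℝ := fun k ↦ (Set.Ioc (-Real.pi * Real.sqrt k) (Real.pi * Real.sqrt k)).indicator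
    fun u ↦ (1 - p * (1 - Real.cos (u / Real.sqrt k))) ^ k with hF
  -- The Gaussian majorant has this rate because cos t ≤ 1 - 2t²/π² for |t| ≤ π.
  have hc : 0 < 2 * p / Real.pi ^ 2 := by positivity
  have hnn (t : ℝ) : 0 ≤ 1 - p * (1 - Real.cos t) := by
    nlinarith [Real.neg_one_le_cos t, Real.cos_le_one t]
  have hlim : Tendsto (fun k ↦ ∫ u, F k u) atTop (𝓝 (∫ u : ℝ, Real.exp (-(p / 2) * u ^ 2))) := by
    refine tendsto_integral_filter_of_dominated_convergence
      (fun u ↦ Real.exp (-(2 * p / Real.pi ^ 2) * u ^ 2)) (Eventually.of_forall fun k ↦ ?_) ?_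
      (integrable_exp_neg_mul_sq hc) (ae_of_all _ fun u ↦ ?_)
    · exact (Continuous.aestronglyMeasurable (by fun_prop)).indicator measurableSet_Ioc
    · filter_upwards [eventually_gt_atTop 0] with k hk
      refine ae_of_all _ fun u ↦ ?_
      have hk' : (0 : ℝ) < k := by exact_mod_cast hk
      have hs := Real.sqrt_pos.mpr hk'
      simp only [hF]
      by_cases hu : u ∈ Set.Ioc (-Real.pi * Real.sqrt k) (Real.pi * Real.sqrt k)
      · rw [Set.indicator_of_mem hu, Real.norm_of_nonneg (pow_nonneg (hnn _) _)]
        have h1 : |u / Real.sqrt k| ≤ Real.pi := by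
          rw [abs_le, le_div_iff₀ hs, div_le_iff₀ hs]
          exact ⟨hu.1.le, hu.2⟩
        have h2 := Real.cos_le_one_sub_mul_cos_sq h1
        have h3 : 1 - p * (1 - Real.cos (u / Real.sqrt k)) ≤
            Real.exp (-(2 * p / Real.pi ^ 2) * (u / Real.sqrt k) ^ 2) := by
          refine le_trans ?_ (Real.add_one_le_exp _)
          have := mul_le_mul_of_nonneg_left h2 hp.le
          have h4 : p * (1 - 2 / Real.pi ^ 2 * (u / Real.sqrt k) ^ 2) =
            p - 2 * p / Real.pi ^ 2 * (u / Real.sqrt k) ^ 2 := by ring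
          linarith
        refine (pow_le_pow_left₀ (hnn _) h3 k).trans_eq ?_
        rw [← Real.exp_nat_mul, div_pow, Real.sq_sqrt hk'.le]
        congr 1
        field_simp
      · rw [Set.indicator_of_notMem hu, norm_zero]
        positivity
    · have h1 : Tendsto (fun k : ℕ ↦ (1 - p * (1 - Real.cos (u / Real.sqrt k))) ^ k) atTop
          (𝓝 (Real.exp (-(p / 2) * u ^ 2))) := by
        have h2 : Tendsto (fun k : ℕ ↦ (k : ℝ) * (-(p * (1 - Real.cos (u / Real.sqrt k))))) atTop
            (𝓝 (-(p / 2) * u ^ 2)) := by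
          have h3 := (tendsto_mul_one_sub_cos u).const_mul (-p)
          rw [show -p * (u ^ 2 / 2) = -(p / 2) * u ^ 2 by ring] at h3
          refine h3.congr fun k ↦ by ring
        refine (Real.tendsto_one_add_pow_exp_of_tendsto h2).congr fun k ↦ by ring
      refine h1.congr' ?_
      have h4 : Tendsto (fun k : ℕ ↦ Real.pi * Real.sqrt k) atTop atTop :=
        (Real.tendsto_sqrt_atTop.comp tendsto_natCast_atTop_atTop).const_mul_atTop Real.pi_pos
      filter_upwards [h4.eventually_gt_atTop |u|] with k hk
      have hu := abs_lt.mp hk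
      have hmem : u ∈ Set.Ioc (-Real.pi * Real.sqrt k) (Real.pi * Real.sqrt k) :=
        ⟨by linarith [hu.1], hu.2.le⟩
      simp only [hF, Set.indicator_of_mem hmem]
  refine hlim.congr' ?_
  filter_upwards [eventually_gt_atTop 0] with k hk
  have hk' : (0 : ℝ) < k := by exact_mod_cast hk
  have hs := Real.sqrt_pos.mpr hk'
  have h1 := intervalIntegral.integral_comp_div (a := -Real.pi * Real.sqrt k)
    (b := Real.pi * Real.sqrt k) (fun t ↦ (1 - p * (1 - Real.cos t)) ^ k) hs.ne'
  rw [mul_div_assoc, mul_div_assoc, div_self hs.ne', mul_one, mul_one] at h1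
  rw [hF, integral_indicator measurableSet_Ioc, ← intervalIntegral.integral_of_le, h1, smul_eq_mul]
  nlinarith [Real.pi_pos]

/-! ### Asymptotics and growth rate of the projection norms -/

namespace RotatedOscillator

/-- Laplace's integral with y = |sin θ|/cos θ, after extracting the maximum of the base, attained at
t = 0. -/
theorem norm_eigenProjection_eq_integral {θ : ℝ} (hθ : 0 < Real.cos θ) (k : ℕ) :
    ‖eigenProjection θ k‖ = (Real.cos θ) ^ (-(1 / 2) : ℝ) * (2 * Real.pi)⁻¹ *
      ((1 + |Real.sin θ|) / Real.cos θ) ^ k *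
      ∫ t in (-Real.pi)..Real.pi,
        (1 - |Real.sin θ| / (1 + |Real.sin θ|) * (1 - Real.cos t)) ^ k := by
  have h1 : (|Real.sin θ| / Real.cos θ) ^ 2 = (1 / Real.cos θ) ^ 2 - 1 := by
    rw [div_pow, sq_abs]
    field_simp
    linarith [Real.sin_sq_add_cos_sq θ]
  have h2 := legendrePoly_eval_eq_integral h1 k
  have h3 : (legendrePoly k).eval (1 / Real.cos θ) = (2 * Real.pi)⁻¹ *
      ∫ t in (-Real.pi)..Real.pi, (1 / Real.cos θ + |Real.sin θ| / Real.cos θ * Real.cos t) ^ k := by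
    rw [← h2, inv_mul_cancel_left₀ (by positivity)]
  have h4 : ∫ t in (-Real.pi)..Real.pi,
      (1 / Real.cos θ + |Real.sin θ| / Real.cos θ * Real.cos t) ^ k =
      ((1 + |Real.sin θ|) / Real.cos θ) ^ k * ∫ t in (-Real.pi)..Real.pi,
        (1 - |Real.sin θ| / (1 + |Real.sin θ|) * (1 - Real.cos t)) ^ k := by
    rw [← intervalIntegral.integral_const_mul]
    refine intervalIntegral.integral_congr fun t _ ↦ ?_
    have : 1 + |Real.sin θ| ≠ 0 := by positivity
    rw [← mul_pow]
    congr 1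
    field_simp
    ring
  rw [norm_eigenProjection hθ, h3, h4]
  ring

theorem isEquivalent_norm_eigenProjection {θ : ℝ} (hθ : 0 < Real.cos θ) (hs : Real.sin θ ≠ 0) :
    Asymptotics.IsEquivalent atTop (fun k : ℕ ↦ ‖eigenProjection θ k‖)
      (fun k : ℕ ↦ (2 * Real.pi * (k : ℝ) * |Real.sin θ|) ^ (-(1 / 2) : ℝ) *
        ((1 + |Real.sin θ|) / Real.cos θ) ^ ((k : ℝ) + 1 / 2)) := by
  set s := |Real.sin θ| with hs_def
  have hs0 : 0 < s := abs_pos.mpr hs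
  have hs1 : s ≤ 1 := Real.abs_sin_le_one θ
  set a := Real.cos θ with ha
  refine Asymptotics.isEquivalent_of_tendsto_one ?_
  have hp : s / (1 + s) ≤ 1 / 2 := by
    rw [div_le_div_iff₀ (by positivity) two_pos]
    linarith
  have h1 := (tendsto_sqrt_mul_integral_pow (by positivity : 0 < s / (1 + s)) hp).mul_const
    ((Real.sqrt a)⁻¹ * (2 * Real.pi)⁻¹ * Real.sqrt (2 * Real.pi * s) *
      (Real.sqrt ((1 + s) / a))⁻¹)
  have h2 : Real.sqrt (2 * Real.pi / (s / (1 + s))) * ((Real.sqrt a)⁻¹ * (2 * Real.pi)⁻¹ *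
      Real.sqrt (2 * Real.pi * s) * (Real.sqrt ((1 + s) / a))⁻¹) = 1 := by
    have h3 : Real.sqrt (2 * Real.pi / (s / (1 + s))) * Real.sqrt (2 * Real.pi * s) =
        Real.sqrt a * (2 * Real.pi) * Real.sqrt ((1 + s) / a) := by
      have h4 : Real.sqrt a * (2 * Real.pi) * Real.sqrt ((1 + s) / a) =
          Real.sqrt (a * (2 * Real.pi) ^ 2 * ((1 + s) / a)) := by
        rw [Real.sqrt_mul (by positivity), Real.sqrt_mul hθ.le, Real.sqrt_sq (by positivity)]
      rw [h4, ← Real.sqrt_mul (by positivity)]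
      congr 1
      field_simp
    have h5 : Real.sqrt a ≠ 0 := (Real.sqrt_pos.mpr hθ).ne'
    have h6 : Real.sqrt ((1 + s) / a) ≠ 0 := (Real.sqrt_pos.mpr (by positivity)).ne'
    calc _ = (Real.sqrt (2 * Real.pi / (s / (1 + s))) * Real.sqrt (2 * Real.pi * s)) *
          ((Real.sqrt a)⁻¹ * (2 * Real.pi)⁻¹ * (Real.sqrt ((1 + s) / a))⁻¹) := by ring
      _ = 1 := by
        rw [h3]
        field_simp
  rw [h2] at h1
  refine h1.congr' ?_
  filter_upwards [eventually_gt_atTop 0] with k hk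
  have hk' : (0 : ℝ) < k := by exact_mod_cast hk
  rw [Pi.div_apply, norm_eigenProjection_eq_integral hθ, ← hs_def, ← ha,
    Real.rpow_neg hθ.le, Real.rpow_neg (by positivity), ← Real.sqrt_eq_rpow, ← Real.sqrt_eq_rpow,
    Real.rpow_add (by positivity), Real.rpow_natCast, ← Real.sqrt_eq_rpow,
    show 2 * Real.pi * k * s = k * (2 * Real.pi * s) by ring, Real.sqrt_mul hk'.le]
  have h5 : Real.sqrt a ≠ 0 := (Real.sqrt_pos.mpr hθ).ne'
  have h6 : Real.sqrt ((1 + s) / a) ≠ 0 := (Real.sqrt_pos.mpr (by positivity)).ne'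
  have h7 : Real.sqrt k ≠ 0 := (Real.sqrt_pos.mpr hk').ne'
  have h8 : Real.sqrt (2 * Real.pi * s) ≠ 0 := (Real.sqrt_pos.mpr (by positivity)).ne'
  have h9 : ((1 + s) / a) ^ k ≠ 0 := by positivity
  generalize Real.sqrt ((1 + s) / a) = c at *
  generalize ((1 + s) / a) ^ k = d at *
  generalize Real.sqrt (2 * Real.pi * s) = e at *
  field_simp

end RotatedOscillator

/-- After dividing by k, only the exponential factor survives the logarithm. -/
theorem tendsto_log_div_of_isEquivalent {f : ℕ → ℝ} {C B : ℝ} (hC : 0 < C) (hB : 0 < B)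
    (h : Asymptotics.IsEquivalent atTop f
      (fun k : ℕ ↦ (C * (k : ℝ)) ^ (-(1 / 2) : ℝ) * B ^ ((k : ℝ) + 1 / 2))) :
    Tendsto (fun k : ℕ ↦ Real.log (f k) / k) atTop (𝓝 (Real.log B)) := by
  obtain ⟨φ, hφ, hf⟩ := Asymptotics.isEquivalent_iff_exists_eq_mul.mp h
  have h1 : Tendsto (fun k : ℕ ↦ Real.log (φ k) / k) atTop (𝓝 0) := by
    have := (Real.continuousAt_log one_ne_zero).tendsto.comp hφ
    exact this.div_atTop tendsto_natCast_atTop_atTop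
  have h2 : Tendsto (fun k : ℕ ↦ Real.log k / k) atTop (𝓝 0) :=
    Real.isLittleO_log_id_atTop.tendsto_div_nhds_zero.comp tendsto_natCast_atTop_atTop
  have h3 : Tendsto (fun k : ℕ ↦ (-(1 / 2) * Real.log C + 1 / 2 * Real.log B) / k) atTop (𝓝 0) :=
    tendsto_const_nhds.div_atTop tendsto_natCast_atTop_atTop
  have h4 := ((h1.add (h2.const_mul (-(1 / 2)))).add h3).add_const (Real.log B)
  rw [mul_zero, add_zero, add_zero, zero_add] at h4
  refine h4.congr' ?_
  filter_upwards [eventually_gt_atTop 0, hf, hφ.eventually_ne one_ne_zero] with k hk hfk hφk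
  have hk' : (0 : ℝ) < k := by exact_mod_cast hk
  rw [hfk, Pi.mul_apply, Real.log_mul hφk (by positivity), Real.log_mul (by positivity)
    (by positivity), Real.log_rpow (by positivity), Real.log_rpow hB, Real.log_mul hC.ne' hk'.ne']
  field_simp
  ring

namespace RotatedOscillator

theorem tendsto_log_norm_eigenProjection {θ : ℝ} (hθ : 0 < Real.cos θ) :
    Tendsto (fun k : ℕ ↦ Real.log ‖eigenProjection θ k‖ / (k : ℝ)) atTop
      (𝓝 (1 / 2 * Real.log ((1 + |Real.sin θ|) / (1 - |Real.sin θ|)))) := by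
  -- Without rotation the sharp asymptotics is unavailable, but every norm is 1 and both sides are
  -- 0.
  rcases eq_or_ne (Real.sin θ) 0 with hs | hs
  · have hc : Real.cos θ = 1 := by
      have := Real.sin_sq_add_cos_sq θ
      rw [hs] at this
      nlinarith
    have h (k : ℕ) : ‖eigenProjection θ k‖ = 1 := by
      rw [norm_eigenProjection_eq_integral hθ, hs, hc]
      simp
      field_simp
      norm_num
    simp [h, hs]
  · have hs0 : 0 < |Real.sin θ| := abs_pos.mpr hs
    have h1 := isEquivalent_norm_eigenProjection hθ hs
    have h2 : ∀ k : ℕ, 2 * Real.pi * (k : ℝ) * |Real.sin θ| = 2 * Real.pi * |Real.sin θ| * k :=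
      fun k ↦ by ring
    simp only [h2] at h1
    have h3 := tendsto_log_div_of_isEquivalent (by positivity) (by positivity) h1
    have hcs : Real.cos θ ^ 2 = (1 + |Real.sin θ|) * (1 - |Real.sin θ|) := by
      linear_combination Real.sin_sq_add_cos_sq θ + sq_abs (Real.sin θ)
    have h4 : 0 < 1 - |Real.sin θ| := by
      have : 0 < (1 + |Real.sin θ|) * (1 - |Real.sin θ|) := hcs ▸ pow_pos hθ 2
      exact pos_of_mul_pos_right this (by positivity)
    have h5 : (1 + |Real.sin θ|) / (1 - |Real.sin θ|) =
        ((1 + |Real.sin θ|) / Real.cos θ) ^ 2 := by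
      rw [div_pow, hcs]
      field_simp
    rw [h5, Real.log_pow]
    convert! h3 using 2
    push_cast
    ring

end RotatedOscillator

end

/-- The existential over P loses nothing, since spectral projections are unique
(`UnboundedOp.IsSpectralProjection.unique`). -/
theorem mainTheorem4 (θ : ℝ) (hθ : |θ| < Real.pi / 2) :
    ∃ P : ℕ → (RotatedOscillator.L2 →L[ℂ] RotatedOscillator.L2),
      (∀ k : ℕ,
        UnboundedOp.HasEigenvalue (RotatedOscillator.H θ) (2 * (k : ℂ) + 1) ∧
        UnboundedOp.IsSpectralProjection (RotatedOscillator.H θ) (2 * (k : ℂ) + 1) (P k)) ∧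
      (∀ k : ℕ, ‖P k‖ = (Real.cos θ) ^ (-(1 / 2) : ℝ) *
        (legendrePoly k).eval (1 / Real.cos θ)) ∧
      (θ ≠ 0 →
        Asymptotics.IsEquivalent atTop (fun k : ℕ ↦ ‖P k‖)
          (fun k : ℕ ↦ (2 * Real.pi * (k : ℝ) * |Real.sin θ|) ^ (-(1 / 2) : ℝ) *
            ((1 + |Real.sin θ|) / Real.cos θ) ^ ((k : ℝ) + 1 / 2))) ∧
      Tendsto (fun k : ℕ ↦ Real.log ‖P k‖ / (k : ℝ)) atTop
        (𝓝 (1 / 2 * Real.log ((1 + |Real.sin θ|) / (1 - |Real.sin θ|)))) := by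
  have h := abs_lt.mp hθ
  have hc : 0 < Real.cos θ := Real.cos_pos_of_mem_Ioo ⟨h.1, h.2⟩
  refine ⟨RotatedOscillator.eigenProjection θ,
    fun k ↦ ⟨RotatedOscillator.hasEigenvalue hc k,
      RotatedOscillator.isSpectralProjection_eigenProjection hc k⟩,
    RotatedOscillator.norm_eigenProjection hc, fun h0 ↦ ?_,
    RotatedOscillator.tendsto_log_norm_eigenProjection hc⟩
  refine RotatedOscillator.isEquivalent_norm_eigenProjection hc fun hs ↦ h0 ?_
  exact (Real.sin_eq_zero_iff_of_lt_of_lt (by linarith [h.1, Real.pi_pos])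
    (by linarith [h.2, Real.pi_pos])).mp hs
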